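/- Let $d\in\mathbb N$, let $|\cdot|$ be the Euclidean norm and $x\cdot y$ the Euclidean scalar product on $\mathbb R^d$. For a real symmetric $d\times d$ matrix $H=(h_{ij})$ write $|x|_H^2=Hx\cdot x$. The space of symmetric matrices carries the Lebesgue measure $\prod_{1\le j\le i\le d}dh_{ij}$. There is $r=r(d)>0$ such that for almost every symmetric matrix $H$ with $|h_{ij}-\delta_{ij}|\le r$ for all $i,j$ (where $\delta_{ij}$ is the Kronecker symbol) the following holds. For every $\kappa>0$ there is a constant $C=C(d,H,\kappa)>0$ such that for all real $L\ge 1$ and $\delta$ with $L^{2-d+\kappa}<\delta<1$: - for every $\zeta\in\mathbb Z^d$ with $1\le|\zeta|\le L$, $$\#\{\xi\in\mathbb Z^d:\ |\xi|\le L,\ |H\zeta\cdot\xi|<\delta\}\le C\,L^{d-1}\sqrt\delta ;$$ - for every $a\in\mathbb R$, $$\#\{\eta\in\mathbb Z^d:\ |\eta|<L,\ \bigl||\eta|_H^2-a\bigr|<\delta\}\le C\,L^{d-1}\sqrt\delta ;$$ - for every $a\in\mathbb R$, $$\#\{(\xi,\eta)\in\mathbb Z^d\times\mathbb Z^d:\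 |\xi|\le L,\ |\eta|\le L,\ |H\xi\cdot\eta-a|\le\delta\}\le C\,L^{2d-2}\,\delta .$$ -/

import Mathlib

open MeasureTheory
open scoped Matrix

/-- The symmetric `d × d` matrix `H = (h_{ij})` with coordinates `h_{ij} = h_{ji}`, one real
coordinate for each unordered pair `{i, j}` (the diagonal pairs `{i, i}` included).  The product
Lebesgue measure `∏_{j ≤ i} dh_{ij}` on these coordinates is the Lebesgue measure on the space of
symmetric matrices. -/
def symMatrix {d : ℕ} (h : Sym2 (Fin d) → ℝ) : Matrix (Fin d) (Fin d) ℝ :=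
  Matrix.of fun i j => h s(i, j)

/-- A lattice point of `ℤ^d`, viewed as a vector with real coordinates. -/
def latticeVec {d : ℕ} (ξ : Fin d → ℤ) : Fin d → ℝ := fun i => (ξ i : ℝ)

/-- The Euclidean length `|ξ|` of a lattice point. -/
noncomputable def latticeNorm {d : ℕ} (ξ : Fin d → ℤ) : ℝ :=
  ‖(WithLp.toLp 2 (latticeVec ξ) : EuclideanSpace ℝ (Fin d))‖

/-- The bilinear form `H ξ · η` on lattice points. -/
def latticeForm {d : ℕ} (H : Matrix (Fin d) (Fin d) ℝ) (ξ η : Fin d → ℤ) : ℝ :=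
  (H *ᵥ latticeVec ξ) ⬝ᵥ latticeVec η

/-- The quadratic form `|ξ|_H^2 = H ξ · ξ` on lattice points. -/
def latticeQuad {d : ℕ} (H : Matrix (Fin d) (Fin d) ℝ) (ξ : Fin d → ℤ) : ℝ :=
  latticeForm H ξ ξ

/-- `# S ≤ B`: the set `S` is finite and has at most `B` elements. -/
def CountLe {α : Type*} (S : Set α) (B : ℝ) : Prop :=
  S.Finite ∧ (S.ncard : ℝ) ≤ B

/-! The slab estimates rest on duality. Fix `ζ ≠ 0` and put `v = Hζ`, of size comparable to `|ζ|`.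
If `X` consists of `ξ` in the box of size `R` with `ξ · v` within `δ` of `a`, then up to a
unimodular factor the exponential sum over `X` does not cancel at points `s v + y` with `|s| ≲ 1/δ`,
`|y| ≲ 1/R`. Comparing the resulting lower bound for its `L²` mass on this tube with its `L²` norm
on the torus gives `|X| ≲ R^(d-1) δ M(ζ) / |ζ|`, where `M(ζ)` (`dualCount`) counts integer points in
the doubled tube (`card_mul_le_ncard_latticeTube`, `card_slab_le`).

For random `H`, a fixed `n ≠ 0` lies within `ρ` of the line through `Hζ` with probability `≲
(ρ/|n|)^(d-1)` (`symBoxMeasure_nearLine_le`). Hence the expected number of such `n` with `|n| ≤ T`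
is `≲ T ρ^(d-1)`. Two weighted sums of these counts over `|ζ| ≤ R`, collected in `badSum`, have mean
`≲ R^(2-d)/δ`. At `δ = R^(2-d+κ)` this is `R^(-κ)`, summable over dyadic `R`, so almost every `H`
has `badSum` bounded at all dyadic scales (`ae_exists_badSum_le`).

The first part of `badSum` controls `∑ M(ζ)/|ζ|`, and with it the bilinear count. The second
controls, for each single `ζ`, the tube shrunk by a factor of order `|ζ|`. Log-convexity of tube
counts (`ncard_latticeTube_sq_le`) together with a trivial bound for the tube enlarged by `|ζ| + 1`
then gives `M(ζ) ≲ |ζ|/√δ`, which is the slab bound with `√δ`. The quadratic count reduces to the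
bilinear one through `H(η-ξ)·(η+ξ) = |η|_H² - |ξ|_H²`, and the square root comes from counting pairs
`(η, ξ)`. -/

/-- The integer points within sup-distance `ρ` of the segment `{s v : |s| ≤ S}`. -/
def latticeTube {d : ℕ} (v : Fin d → ℝ) (S ρ : ℝ) : Set (Fin d → ℤ) :=
  {n | ∃ s : ℝ, |s| ≤ S ∧ ∀ i, |(n i : ℝ) - s * v i| ≤ ρ}

/-! ### Exponential sums on the torus. -/

/-- The exponential sum with frequencies in a finite set of lattice points. -/
noncomputable def expSum {d : ℕ} (X : Finset (Fin d → ℤ)) (x : Fin d → ℝ) : ℂ :=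
  ∑ ξ ∈ X, Complex.exp (2 * Real.pi * Complex.I * ((∑ i, (ξ i : ℝ) * x i : ℝ) : ℂ))

theorem continuous_expSum {d : ℕ} (X : Finset (Fin d → ℤ)) : Continuous (expSum X) := by
  unfold expSum
  fun_prop

theorem expSum_add_int {d : ℕ} (X : Finset (Fin d → ℤ)) (x : Fin d → ℝ) (n : Fin d → ℤ) :
    expSum X (fun i => x i + n i) = expSum X x := by
  unfold expSum
  refine Finset.sum_congr rfl fun ξ _ => ?_
  rw [Complex.exp_eq_exp_iff_exists_int]
  refine ⟨∑ i, ξ i * n i, ?_⟩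
  push_cast
  simp only [mul_add, Finset.sum_add_distrib]
  ring

theorem integral_exp_int (k : ℤ) :
    ∫ t in Set.Ico (0 : ℝ) 1, Complex.exp (2 * Real.pi * Complex.I * ((k * t : ℝ) : ℂ))
      = if k = 0 then 1 else 0 := by
  rw [integral_Ico_eq_integral_Ioc, ← intervalIntegral.integral_of_le zero_le_one]
  split_ifs with hk
  · simp [hk]
  · have hc : (2 * Real.pi * Complex.I * k : ℂ) ≠ 0 := by
      simp [Real.pi_ne_zero, hk]
    have := integral_exp_mul_complex (a := 0) (b := 1) hc
    have h2 : ∀ t : ℝ, (2 * Real.pi * Complex.I * ((k * t : ℝ) : ℂ))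
        = (2 * Real.pi * Complex.I * k : ℂ) * t := by
      intro t; push_cast; ring
    simp only [h2, this]
    have : Complex.exp (2 * Real.pi * Complex.I * k * (1 : ℝ)) = 1 := by
      rw [Complex.exp_eq_one_iff]; exact ⟨k, by push_cast; ring⟩
    rw [this]; simp

theorem integral_unitCube_exp {d : ℕ} (k : Fin d → ℤ) :
    ∫ x in Set.univ.pi fun _ : Fin d => Set.Ico (0 : ℝ) 1,
      Complex.exp (2 * Real.pi * Complex.I * ((∑ i, (k i : ℝ) * x i : ℝ) : ℂ))
      = if k = 0 then 1 else 0 := by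
  have h1 : ∀ x : Fin d → ℝ,
      Complex.exp (2 * Real.pi * Complex.I * ((∑ i, (k i : ℝ) * x i : ℝ) : ℂ))
        = ∏ i, Complex.exp (2 * Real.pi * Complex.I * (((k i : ℝ) * x i : ℝ) : ℂ)) := by
    intro x
    rw [← Complex.exp_sum, Complex.ofReal_sum, Finset.mul_sum]
  simp only [h1]
  rw [volume_pi, Measure.restrict_pi_pi]
  rw [integral_fintype_prod_eq_prod (𝕜 := ℂ) (μ := fun _ : Fin d => volume.restrict (Set.Ico (0:ℝ) 1))
    (fun (i : Fin d) (t : ℝ) => Complex.exp (2 * Real.pi * Complex.I * (((k i : ℝ) * t : ℝ) : ℂ)))]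
  simp only [integral_exp_int]
  split_ifs with hk
  · simp [hk]
  · obtain ⟨i, hi⟩ := Function.ne_iff.1 hk
    exact Finset.prod_eq_zero (Finset.mem_univ i) (if_neg hi)

theorem isFiniteMeasure_unitCube (d : ℕ) :
    IsFiniteMeasure (volume.restrict (Set.univ.pi fun _ : Fin d => Set.Ico (0 : ℝ) 1)) :=
  ⟨by simp [volume_pi_pi]⟩

/-- Parseval: after expanding the square only the diagonal terms survive integration. -/
theorem lintegral_expSum {d : ℕ} (X : Finset (Fin d → ℤ)) :
    ∫⁻ x in Set.univ.pi fun _ : Fin d => Set.Ico (0 : ℝ) 1,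
      ENNReal.ofReal (‖expSum X x‖ ^ 2) = ENNReal.ofReal X.card := by
  have hfin := isFiniteMeasure_unitCube d
  have hb : ∀ (k : Fin d → ℤ) (x : Fin d → ℝ),
      ‖Complex.exp (2 * Real.pi * Complex.I * ((∑ i, (k i : ℝ) * x i : ℝ) : ℂ))‖ = 1 := by
    intro k x
    rw [Complex.norm_exp]
    simp
  have hbound : ∀ x, ‖expSum X x‖ ≤ X.card := by
    intro x
    refine (norm_sum_le _ _).trans ?_
    simp only [hb, Finset.sum_const, nsmul_eq_mul, mul_one, le_refl]
  have hint : Integrable (fun x => ‖expSum X x‖ ^ 2)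
      (volume.restrict (Set.univ.pi fun _ : Fin d => Set.Ico (0 : ℝ) 1)) := by
    refine Integrable.of_bound ((continuous_expSum X).norm.pow 2).aestronglyMeasurable
      ((X.card : ℝ) ^ 2) (Filter.Eventually.of_forall fun x => ?_)
    rw [Real.norm_of_nonneg (by positivity)]
    gcongr
    exact hbound x
  rw [← ofReal_integral_eq_lintegral_ofReal hint
    (Filter.Eventually.of_forall fun x => by positivity)]
  congr 1
  have h2 : ∀ x, ((‖expSum X x‖ ^ 2 : ℝ) : ℂ) = ∑ ξ ∈ X, ∑ η ∈ X,
      Complex.exp (2 * Real.pi * Complex.I * ((∑ i, ((ξ - η) i : ℝ) * x i : ℝ) : ℂ)) := by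
    intro x
    rw [Complex.ofReal_pow, ← Complex.mul_conj', expSum, map_sum, Finset.sum_mul_sum]
    refine Finset.sum_congr rfl fun ξ _ => Finset.sum_congr rfl fun η _ => ?_
    rw [← Complex.exp_conj, ← Complex.exp_add]
    congr 1
    simp only [map_mul, Complex.conj_I, Complex.conj_ofReal, Pi.sub_apply, map_ofNat]
    push_cast
    simp only [sub_mul, Finset.sum_sub_distrib]
    ring
  have h3 : ((∫ x in Set.univ.pi fun _ : Fin d => Set.Ico (0 : ℝ) 1, ‖expSum X x‖ ^ 2 : ℝ) : ℂ)
      = X.card := by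
    rw [← integral_complex_ofReal]
    simp only [h2]
    have hi : ∀ k : Fin d → ℤ, Integrable (fun x : Fin d → ℝ =>
        Complex.exp (2 * Real.pi * Complex.I * ((∑ i, (k i : ℝ) * x i : ℝ) : ℂ)))
        (volume.restrict (Set.univ.pi fun _ : Fin d => Set.Ico (0 : ℝ) 1)) := fun k =>
      Integrable.of_bound (Continuous.aestronglyMeasurable (by fun_prop)) 1
        (Filter.Eventually.of_forall fun x => (hb k x).le)
    rw [integral_finsetSum _ fun ξ _ => integrable_finsetSum _ fun η _ => hi (ξ - η)]
    have : ∀ ξ ∈ X, ∫ x in Set.univ.pi fun _ : Fin d => Set.Ico (0 : ℝ) 1, ∑ η ∈ X,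
      Complex.exp (2 * Real.pi * Complex.I * ((∑ i, ((ξ - η) i : ℝ) * x i : ℝ) : ℂ)) = 1 := by
      intro ξ hξ
      rw [integral_finsetSum _ fun η _ => hi (ξ - η)]
      simp only [integral_unitCube_exp, sub_eq_zero]
      simp [hξ]
    rw [Finset.sum_congr rfl this]
    simp
  exact_mod_cast h3

/-- The integer translates of the half-open cube tile space, the cell of `x` being given by the
floors of its coordinates. This folds the integral over the tube onto the torus. -/
theorem lintegral_eq_tsum_unitCube {d : ℕ} (f : (Fin d → ℝ) → ENNReal) :
    ∫⁻ x, f x = ∑' n : Fin d → ℤ, ∫⁻ x in Set.univ.pi fun _ : Fin d => Set.Ico (0 : ℝ) 1,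
      f (fun i => x i + n i) := by
  set Q : Set (Fin d → ℝ) := Set.univ.pi fun _ : Fin d => Set.Ico (0 : ℝ) 1 with hQ
  have hQm : MeasurableSet Q := MeasurableSet.univ_pi fun _ => measurableSet_Ico
  let c : (Fin d → ℤ) → Set (Fin d → ℝ) := fun n => {x | ∀ i, ⌊x i⌋ = n i}
  have hc : ∀ n, MeasurableSet (c n) := fun n =>
    measurableSet_setOfPred.2 (Measurable.forall fun i => by
      have : Measurable fun x : Fin d → ℝ => ⌊x i⌋ := Int.measurable_floor.comp (measurable_pi_apply i)
      exact measurableSet_setOfPred.1 (this (measurableSet_singleton (n i))))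
  have hdisj : Pairwise (Function.onFun Disjoint c) := by
    intro m n hmn
    refine Set.disjoint_left.2 fun x hx hy => hmn ?_
    funext i; rw [← hx i, ← hy i]
  have huniv : (⋃ n, c n) = Set.univ :=
    Set.eq_univ_of_forall fun x => Set.mem_iUnion.2 ⟨fun i => ⌊x i⌋, fun i => rfl⟩
  rw [← setLIntegral_univ, ← huniv, lintegral_iUnion hc hdisj]
  congr 1; funext n
  rw [← lintegral_indicator (hc n), ← lintegral_indicator hQm,
    ← lintegral_add_right_eq_self _ (fun i => (n i : ℝ))]
  congr 1; funext x
  have : (x + fun i => (n i : ℝ)) ∈ c n ↔ x ∈ Q := by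
    simp only [c, hQ, Set.mem_ofPred_eq, Set.mem_univ_pi, Pi.add_apply, Int.floor_add_intCast,
      add_eq_right, Int.floor_eq_zero_iff]
  by_cases hx : x ∈ Q
  · rw [Set.indicator_of_mem hx, Set.indicator_of_mem (this.2 hx)]; rfl
  · rw [Set.indicator_of_notMem hx, Set.indicator_of_notMem (fun h => hx (this.1 h))]

/-! ### Duality between slabs and tubes. -/

/-- Phases of at most a sixth of a turn have cosine at least `cos (π/3) = 1/2`, so the real parts
add up. -/
theorem norm_sum_exp_ge {ι : Type*} (X : Finset ι) (θ : ι → ℝ) (h : ∀ ξ ∈ X, |θ ξ| ≤ 1 / 6) :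
    (X.card : ℝ) / 2 ≤ ‖∑ ξ ∈ X, Complex.exp (2 * Real.pi * Complex.I * (θ ξ : ℂ))‖ := by
  refine le_trans ?_ (Complex.re_le_norm _)
  rw [Complex.re_sum]
  have : ∀ ξ ∈ X, (1 / 2 : ℝ) ≤ (Complex.exp (2 * Real.pi * Complex.I * (θ ξ : ℂ))).re := by
    intro ξ hξ
    have e1 : (2 * Real.pi * Complex.I * (θ ξ : ℂ)) = ((2 * Real.pi * θ ξ : ℝ) : ℂ) * Complex.I := by
      push_cast; ring
    rw [e1, Complex.exp_ofReal_mul_I_re, ← Real.cos_abs, ← Real.cos_pi_div_three]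
    have hpi := Real.pi_pos
    apply Real.cos_le_cos_of_nonneg_of_le_pi (abs_nonneg _) (by linarith)
    rw [abs_mul, abs_of_pos (by positivity)]
    have := h ξ hξ
    nlinarith
  have := Finset.card_nsmul_le_sum X _ _ this
  simpa [div_eq_mul_inv] using this

theorem volume_slice_le (w x ρ V : ℝ) (hV : 0 < V) (hw : V ≤ |w|) :
    volume {s : ℝ | |x - s * w| ≤ ρ} ≤ ENNReal.ofReal (2 * ρ / V) := by
  have hw0 : 0 < |w| := hV.trans_le hw
  have hw1 : w ≠ 0 := abs_pos.1 hw0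
  have : {s : ℝ | |x - s * w| ≤ ρ} ⊆ Metric.closedBall (x / w) (ρ / V) := by
    intro s hs
    rw [Metric.mem_closedBall, Real.dist_eq, le_div_iff₀ hV]
    have h1 : |s - x / w| * |w| ≤ ρ := by
      rw [← abs_mul, sub_mul, div_mul_cancel₀ _ hw1, abs_sub_comm]; exact hs
    exact (mul_le_mul_of_nonneg_left hw (abs_nonneg _)).trans h1
  refine (measure_mono this).trans ?_
  rw [Real.volume_closedBall, mul_div_assoc]

/-- A slab contains few lattice points unless the dual tube contains many of them. -/
theorem card_mul_le_ncard_latticeTube {d : ℕ} (v : Fin d → ℝ) (a S ρ V : ℝ) (hS : 0 < S)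
    (hρ : 0 < ρ) (hV : 0 < V) (i₀ : Fin d) (hv : V ≤ |v i₀|) (X : Finset (Fin d → ℤ))
    (hX : ∀ ξ ∈ X, ∀ (s : ℝ) (y : Fin d → ℝ), |s| ≤ S → (∀ i, |y i| ≤ ρ) →
      |s * ((∑ i, (ξ i : ℝ) * v i) - a) + ∑ i, (ξ i : ℝ) * y i| ≤ 1 / 6)
    (hfin : (latticeTube v (2 * S) (2 * ρ)).Finite) :
    (X.card : ℝ) * (S * (2 * ρ) ^ d * V) ≤ 4 * ρ * (latticeTube v (2 * S) (2 * ρ)).ncard := by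
  set T := (latticeTube v (2 * S) (2 * ρ)).ncard with hT
  set N : ℝ := (X.card : ℝ) with hN
  have hN0 : 0 ≤ N := Nat.cast_nonneg _
  set Q : Set (Fin d → ℝ) := Set.univ.pi fun _ : Fin d => Set.Ico (0 : ℝ) 1 with hQ
  let G : (Fin d → ℝ) → ENNReal := fun x => ENNReal.ofReal (‖expSum X x‖ ^ 2)
  have hGc : Continuous G := ENNReal.continuous_ofReal.comp ((continuous_expSum X).norm.pow 2)
  have hG : Measurable G := hGc.measurable
  let K : Set (Fin d → ℝ) := Set.univ.pi fun _ => Set.Icc (-ρ) ρ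
  have hK : MeasurableSet K := MeasurableSet.univ_pi fun _ => measurableSet_Icc
  have hKmem : ∀ y, y ∈ K ↔ ∀ i, |y i| ≤ ρ := by
    intro y; simp only [K, Set.mem_univ_pi, Set.mem_Icc, abs_le]
  have hKvol : volume K = ENNReal.ofReal ((2 * ρ) ^ d) := by
    simp only [K, volume_pi_pi, Real.volume_Icc, Finset.prod_const, Finset.card_univ,
      Fintype.card_fin]
    rw [ENNReal.ofReal_pow (by positivity)]
    congr 2; ring
  let χ : (Fin d → ℝ) → ENNReal := K.indicator 1
  have hχ : Measurable χ := measurable_one.indicator hK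
  have hsub : Measurable fun p : ℝ × (Fin d → ℝ) => p.2 - p.1 • v := by fun_prop
  have hχ2 : Measurable fun p : ℝ × (Fin d → ℝ) => χ (p.2 - p.1 • v) := hχ.comp hsub
  have hF : Measurable fun p : ℝ × (Fin d → ℝ) => χ (p.2 - p.1 • v) * G p.2 :=
    hχ2.mul (hG.comp measurable_snd)
  -- Lower bound for the mass: everywhere on the tube the exponential sum has modulus at least `N /
  -- 2`.
  have hlow : ENNReal.ofReal (N ^ 2 / 4 * (2 * ρ) ^ d * (2 * S)) ≤
      ∫⁻ s in Set.Icc (-S) S, ∫⁻ x, χ (x - s • v) * G x := by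
    have h1 : ∀ s ∈ Set.Icc (-S) S, ENNReal.ofReal (N ^ 2 / 4 * (2 * ρ) ^ d) ≤
        ∫⁻ x, χ (x - s • v) * G x := by
      intro s hs
      rw [← lintegral_add_right_eq_self _ (s • v)]
      simp only [add_sub_cancel_right]
      calc ENNReal.ofReal (N ^ 2 / 4 * (2 * ρ) ^ d)
          = ∫⁻ y in K, ENNReal.ofReal (N ^ 2 / 4) := by
            rw [setLIntegral_const, hKvol, ENNReal.ofReal_mul (by positivity)]
        _ ≤ ∫⁻ y, χ y * G (y + s • v) := by
            rw [← lintegral_indicator hK]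
            refine lintegral_mono fun y => ?_
            by_cases hy : y ∈ K
            · simp only [χ, Set.indicator_of_mem hy, Pi.one_apply, one_mul]
              refine ENNReal.ofReal_le_ofReal ?_
              have h2 := norm_sum_exp_ge X
                (fun ξ => s * ((∑ i, (ξ i : ℝ) * v i) - a) + ∑ i, (ξ i : ℝ) * y i)
                (fun ξ hξ => hX ξ hξ s y (abs_le.2 hs) ((hKmem y).1 hy))
              -- The centre `a` of the slab enters only through a unimodular factor.
              have h3 : expSum X (y + s • v) =
                  Complex.exp (((2 * Real.pi * (s * a) : ℝ) : ℂ) * Complex.I) *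
                  ∑ ξ ∈ X, Complex.exp (2 * Real.pi * Complex.I *
                  ((s * ((∑ i, (ξ i : ℝ) * v i) - a) + ∑ i, (ξ i : ℝ) * y i : ℝ) : ℂ)) := by
                rw [expSum, Finset.mul_sum]
                refine Finset.sum_congr rfl fun ξ _ => ?_
                rw [← Complex.exp_add]
                congr 1
                simp only [Pi.add_apply, Pi.smul_apply, smul_eq_mul, mul_add,
                  Finset.sum_add_distrib]
                have : ∑ i, (ξ i : ℝ) * (s * v i) = s * ∑ i, (ξ i : ℝ) * v i := by
                  rw [Finset.mul_sum]; exact Finset.sum_congr rfl fun i _ => by ring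
                rw [this]
                push_cast
                ring
              rw [h3, norm_mul, Complex.norm_exp_ofReal_mul_I, one_mul]
              calc N ^ 2 / 4 = (N / 2) ^ 2 := by ring
                _ ≤ _ := by gcongr
            · rw [Set.indicator_of_notMem hy]; exact zero_le
    calc ENNReal.ofReal (N ^ 2 / 4 * (2 * ρ) ^ d * (2 * S))
        = ∫⁻ s in Set.Icc (-S) S, ENNReal.ofReal (N ^ 2 / 4 * (2 * ρ) ^ d) := by
          rw [setLIntegral_const, Real.volume_Icc, ENNReal.ofReal_mul (by positivity)]
          congr 2; ring
      _ ≤ _ := setLIntegral_mono' measurableSet_Icc h1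
  -- `W x` is the length of the set of parameters `s` for which `x` is within `ρ` of `s v`. The
  -- coordinate `i₀` alone bounds it by `2ρ/V`.
  let W : (Fin d → ℝ) → ENNReal := fun x => ∫⁻ s in Set.Icc (-S) S, χ (x - s • v)
  have hW : Measurable W := by
    have : Measurable (Function.uncurry fun (x : Fin d → ℝ) (s : ℝ) => χ (x - s • v)) :=
      hχ2.comp measurable_swap
    exact this.lintegral_prod_right
  have hWle : ∀ x, W x ≤ ENNReal.ofReal (2 * ρ / V) := by
    intro x
    have hm : MeasurableSet {s : ℝ | |x i₀ - s * v i₀| ≤ ρ} :=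
      (isClosed_le (by fun_prop) continuous_const).measurableSet
    calc W x ≤ ∫⁻ s, χ (x - s • v) := setLIntegral_le_lintegral _ _
      _ ≤ ∫⁻ s, {s : ℝ | |x i₀ - s * v i₀| ≤ ρ}.indicator 1 s := by
          refine lintegral_mono fun s => ?_
          by_cases hy : x - s • v ∈ K
          · have : s ∈ {s : ℝ | |x i₀ - s * v i₀| ≤ ρ} := by
              simpa using (hKmem _).1 hy i₀
            rw [Set.indicator_of_mem this]
            exact Set.indicator_le_self' (fun _ _ => zero_le) _
          · simp only [χ, Set.indicator_of_notMem hy]; exact zero_le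
      _ ≤ _ := by
          rw [lintegral_indicator_one hm]
          exact volume_slice_le _ _ _ _ hV hv
  have hWne : ∀ x, W x ≠ 0 → ∃ s, |s| ≤ S ∧ ∀ i, |x i - s * v i| ≤ ρ := by
    intro x hx
    by_contra hcon
    push Not at hcon
    refine hx ?_
    have : ∀ s ∈ Set.Icc (-S) S, χ (x - s • v) = 0 := by
      intro s hs
      refine Set.indicator_of_notMem (fun hmem => ?_) _
      obtain ⟨i, hi⟩ := hcon s (abs_le.2 hs)
      exact absurd ((hKmem _).1 hmem i) (by simpa using hi)
    simp only [W]
    rw [setLIntegral_congr_fun measurableSet_Icc this]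
    simp
  -- If two integer translates of `x` lie in the tube, their difference is an integer point of the
  -- doubled tube. So at most `T` translates contribute.
  have hsum : ∀ x : Fin d → ℝ, ∑' n : Fin d → ℤ, W (fun i => x i + n i) ≤
      ENNReal.ofReal (T * (2 * ρ / V)) := by
    intro x
    by_cases hz : ∀ n : Fin d → ℤ, W (fun i => x i + n i) = 0
    · simp [hz]
    push Not at hz
    obtain ⟨n₀, hn₀⟩ := hz
    obtain ⟨s₀, hs₀, hy₀⟩ := hWne _ hn₀
    classical
    rw [tsum_eq_sum (s := hfin.toFinset.image (· + n₀))]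
    · calc _ ≤ ∑ n ∈ hfin.toFinset.image (· + n₀), ENNReal.ofReal (2 * ρ / V) :=
            Finset.sum_le_sum fun n _ => hWle _
        _ = ENNReal.ofReal (T * (2 * ρ / V)) := by
            rw [Finset.sum_const, Finset.card_image_of_injective _ (add_left_injective n₀),
              nsmul_eq_mul, ENNReal.ofReal_mul (Nat.cast_nonneg _), hT,
              Set.ncard_eq_toFinset_card _ hfin, ENNReal.ofReal_natCast]
    · intro n hn
      by_contra hne
      obtain ⟨s, hs, hy⟩ := hWne _ hne
      refine hn (Finset.mem_image.2 ⟨n - n₀, ?_, by simp⟩)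
      rw [Set.Finite.mem_toFinset]
      refine ⟨s - s₀, (abs_sub _ _).trans (by linarith), fun i => ?_⟩
      have h1 := hy i
      have h2 := hy₀ i
      rw [abs_le] at h1 h2 ⊢
      simp only [Pi.sub_apply, Int.cast_sub]
      constructor <;> nlinarith
  have hup : ∫⁻ s in Set.Icc (-S) S, ∫⁻ x, χ (x - s • v) * G x ≤
      ENNReal.ofReal (T * (2 * ρ / V) * N) := by
    rw [lintegral_lintegral_swap hF.aemeasurable]
    have h1 : ∀ x, ∫⁻ s in Set.Icc (-S) S, χ (x - s • v) * G x = W x * G x := by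
      intro x
      exact lintegral_mul_const _ (hχ2.comp measurable_prodMk_right)
    simp only [h1]
    rw [lintegral_eq_tsum_unitCube]
    have h2 : ∀ (n : Fin d → ℤ) (x : Fin d → ℝ), G (fun i => x i + n i) = G x := by
      intro n x; simp only [G, expSum_add_int]
    simp only [h2]
    rw [← lintegral_tsum]
    · calc _ ≤ ∫⁻ x in Q, ENNReal.ofReal (T * (2 * ρ / V)) * G x := by
            refine lintegral_mono fun x => ?_
            rw [ENNReal.tsum_mul_right]
            exact mul_le_mul_left (hsum x) _
        _ = _ := by
            rw [lintegral_const_mul _ hG, lintegral_expSum,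
              ← ENNReal.ofReal_mul (by positivity)]
    · intro n
      have : Measurable fun x : Fin d → ℝ => (fun i => x i + (n i : ℝ)) := by fun_prop
      exact ((hW.comp this).mul hG).aemeasurable
  have hfinal := (ENNReal.ofReal_le_ofReal_iff (by positivity)).1 (hlow.trans hup)
  -- The lower bound is quadratic in `N` and the upper bound linear, so one factor cancels.
  rcases hN0.eq_or_lt with h0 | h0
  · rw [← h0, zero_mul]; positivity
  · have e : T * (2 * ρ / V) * N = (T * (2 * ρ) * N) / V := by ring
    rw [e, le_div_iff₀ hV] at hfinal
    have : N * (N * (S * (2 * ρ) ^ d * V)) ≤ N * (4 * ρ * T) := by linarith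
    exact le_of_mul_le_mul_left this h0

/-! ### Boxes and shells in the lattice. -/

/-- The sup-norm of a lattice point. -/
def latticeHeight {d : ℕ} (n : Fin d → ℤ) : ℕ := Finset.univ.sup fun i => (n i).natAbs

theorem latticeHeight_le_iff {d : ℕ} {n : Fin d → ℤ} {R : ℕ} :
    latticeHeight n ≤ R ↔ ∀ i, |n i| ≤ (R : ℤ) := by
  simp only [latticeHeight, Finset.sup_le_iff, Finset.mem_univ, true_imp_iff]
  refine forall_congr' fun i => ?_
  rw [Int.abs_eq_natAbs]
  omega

theorem abs_le_latticeHeight {d : ℕ} (n : Fin d → ℤ) (i : Fin d) :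
    |(n i : ℝ)| ≤ latticeHeight n := by
  have := latticeHeight_le_iff.1 (le_refl (latticeHeight n)) i
  exact_mod_cast this

theorem latticeHeight_pos {d : ℕ} {n : Fin d → ℤ} (hn : n ≠ 0) : 0 < latticeHeight n := by
  obtain ⟨i, hi⟩ := Function.ne_iff.1 hn
  have := latticeHeight_le_iff.1 (le_refl (latticeHeight n)) i
  have h2 : 0 < |n i| := abs_pos.2 hi
  omega

theorem exists_abs_eq_latticeHeight {d : ℕ} {n : Fin d → ℤ} (hn : n ≠ 0) :
    ∃ i, |(n i : ℝ)| = latticeHeight n := by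
  obtain ⟨i₀, -⟩ := Function.ne_iff.1 hn
  obtain ⟨i, -, hi⟩ := Finset.exists_mem_eq_sup Finset.univ ⟨i₀, Finset.mem_univ _⟩
    fun i => (n i).natAbs
  refine ⟨i, ?_⟩
  rw [latticeHeight, hi, Nat.cast_natAbs, Int.cast_abs]

/-- The lattice points of sup-norm at most `R`. -/
noncomputable def latticeBox (d R : ℕ) : Finset (Fin d → ℤ) :=
  Fintype.piFinset fun _ => Finset.Icc (-(R : ℤ)) R

theorem mem_latticeBox {d R : ℕ} {n : Fin d → ℤ} : n ∈ latticeBox d R ↔ latticeHeight n ≤ R := by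
  simp [latticeBox, latticeHeight_le_iff, abs_le]

theorem card_latticeBox (d R : ℕ) : (latticeBox d R).card = (2 * R + 1) ^ d := by
  simp only [latticeBox, Fintype.card_piFinset, Int.card_Icc, Finset.prod_const, Finset.card_univ,
    Fintype.card_fin]
  congr 1; omega

theorem card_latticeSphere_le (d R r : ℕ) :
    ((latticeBox d R).filter fun n => n ≠ 0 ∧ latticeHeight n = r).card ≤
      d * (2 * (2 * r + 1) ^ (d - 1)) := by
  classical
  let B : Fin d → Finset (Fin d → ℤ) := fun i =>
    Fintype.piFinset fun j => if j = i then {-(r : ℤ), (r : ℤ)} else Finset.Icc (-(r : ℤ)) r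
  have hB : ∀ i ∈ Finset.univ, (B i).card ≤ 2 * (2 * r + 1) ^ (d - 1) := by
    intro i _
    rw [Fintype.card_piFinset, ← Finset.mul_prod_erase _ _ (Finset.mem_univ i)]
    simp only [if_true]
    refine Nat.mul_le_mul Finset.card_le_two ?_
    rw [Finset.prod_congr rfl (g := fun _ => 2 * r + 1)]
    · simp
    · intro j hj
      rw [if_neg (Finset.ne_of_mem_erase hj), Int.card_Icc]
      omega
  calc _ ≤ (Finset.univ.biUnion B).card := by
        refine Finset.card_le_card fun n hn => ?_
        obtain ⟨-, h0, hr⟩ := Finset.mem_filter.1 hn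
        obtain ⟨i, hi⟩ := exists_abs_eq_latticeHeight h0
        rw [hr] at hi
        refine Finset.mem_biUnion.2 ⟨i, Finset.mem_univ _, Fintype.mem_piFinset.2 fun j => ?_⟩
        split_ifs with hj
        · subst hj
          have : |n j| = (r : ℤ) := by exact_mod_cast hi
          rcases abs_eq (Int.natCast_nonneg r) |>.1 this with h | h <;> simp [h]
        · have := latticeHeight_le_iff.1 hr.le j
          exact Finset.mem_Icc.2 (abs_le.1 this)
    _ ≤ Finset.univ.card * (2 * (2 * r + 1) ^ (d - 1)) := Finset.card_biUnion_le_card_mul _ _ _ hB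
    _ = _ := by simp

theorem sum_latticeBox_le (d R : ℕ) (f : ℕ → ℝ) (hf : ∀ r, 0 ≤ f r) :
    ∑ n ∈ (latticeBox d R).filter (· ≠ 0), f (latticeHeight n) ≤
      2 * d * 3 ^ (d - 1) * ∑ r ∈ Finset.Icc 1 R, (r : ℝ) ^ (d - 1) * f r := by
  have hmaps : ∀ n ∈ (latticeBox d R).filter (· ≠ 0), latticeHeight n ∈ Finset.Icc 1 R := by
    intro n hn
    obtain ⟨h1, h2⟩ := Finset.mem_filter.1 hn
    exact Finset.mem_Icc.2 ⟨latticeHeight_pos h2, mem_latticeBox.1 h1⟩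
  rw [← Finset.sum_fiberwise_of_maps_to hmaps, Finset.mul_sum]
  refine Finset.sum_le_sum fun r hr => ?_
  have h1 : 1 ≤ (r : ℝ) := by exact_mod_cast (Finset.mem_Icc.1 hr).1
  rw [Finset.sum_congr rfl (g := fun _ => f r) fun n hn => by rw [(Finset.mem_filter.1 hn).2],
    Finset.sum_const, nsmul_eq_mul, Finset.filter_filter, ← mul_assoc]
  refine mul_le_mul_of_nonneg_right ?_ (hf r)
  calc _ ≤ ((d * (2 * (2 * r + 1) ^ (d - 1)) : ℕ) : ℝ) := by
        exact_mod_cast card_latticeSphere_le d R r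
    _ ≤ d * (2 * (3 * r) ^ (d - 1)) := by
        push_cast
        gcongr
        linarith
    _ = _ := by rw [mul_pow]; ring

theorem card_Icc_ceil_floor_le (a b : ℝ) (hab : 0 ≤ b - a + 1) :
    ((Finset.Icc ⌈a⌉ ⌊b⌋).card : ℝ) ≤ b - a + 1 := by
  rw [Int.card_Icc]
  rcases le_total 0 (⌊b⌋ + 1 - ⌈a⌉) with h | h
  · have : ((⌊b⌋ + 1 - ⌈a⌉).toNat : ℝ) = ((⌊b⌋ + 1 - ⌈a⌉ : ℤ) : ℝ) := by
      exact_mod_cast congrArg (Int.cast (R := ℝ)) (Int.toNat_of_nonneg h)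
    rw [this]
    push_cast
    linarith [Int.floor_le b, Int.le_ceil a]
  · rw [Int.toNat_of_nonpos h]; simpa using hab

/-! ### Integer points in tubes. -/

/-- Rounding `s` down to a multiple of `1/V` moves `s v` by at most `1` in each coordinate, so the
tube is covered by about `2SV` cubes of half-side `ρ + 1`. -/
theorem latticeTube_finite_and_ncard_le {d : ℕ} (v : Fin d → ℝ) (S ρ V : ℝ) (hS : 0 ≤ S)
    (hρ : 0 ≤ ρ) (hV : 0 < V) (hv : ∀ i, |v i| ≤ V) :
    (latticeTube v S ρ).Finite ∧
      ((latticeTube v S ρ).ncard : ℝ) ≤ (2 * S * V + 3) * (2 * ρ + 3) ^ d := by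
  classical
  let B : ℤ → Finset (Fin d → ℤ) := fun m => Fintype.piFinset fun i =>
    Finset.Icc ⌈m / V * v i - (ρ + 1)⌉ ⌊m / V * v i + (ρ + 1)⌋
  let J : Finset ℤ := Finset.Icc ⌈-(S * V) - 1⌉ ⌊S * V⌋
  have hB : ∀ m, ((B m).card : ℝ) ≤ (2 * ρ + 3) ^ d := by
    intro m
    rw [Fintype.card_piFinset, Nat.cast_prod]
    calc _ ≤ ∏ _i : Fin d, (2 * ρ + 3) := by
          refine Finset.prod_le_prod (fun _ _ => Nat.cast_nonneg _) fun i _ => ?_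
          refine (card_Icc_ceil_floor_le _ _ (by linarith)).trans (by linarith)
      _ = _ := by simp
  have hJ : (J.card : ℝ) ≤ 2 * S * V + 3 := by
    have := mul_nonneg hS hV.le
    exact (card_Icc_ceil_floor_le _ _ (by linarith)).trans (by linarith)
  have hsub : latticeTube v S ρ ⊆ (J.biUnion B : Finset (Fin d → ℤ)) := by
    rintro n ⟨s, hs, hn⟩
    have hfl := Int.floor_le (s * V)
    have hfl2 := Int.lt_floor_add_one (s * V)
    rw [abs_le] at hs
    refine Finset.mem_coe.2 (Finset.mem_biUnion.2 ⟨⌊s * V⌋, Finset.mem_Icc.2 ⟨?_, ?_⟩,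
      Fintype.mem_piFinset.2 fun i => ?_⟩)
    · rw [Int.ceil_le]; nlinarith
    · exact Int.floor_le_floor (by nlinarith)
    · have h1 : |s - ⌊s * V⌋ / V| ≤ 1 / V := by
        have : s - ⌊s * V⌋ / V = (s * V - ⌊s * V⌋) / V := by field_simp
        rw [this, abs_div, abs_of_pos hV]
        gcongr
        rw [abs_le]; constructor <;> linarith
      have h2 : |s * v i - ⌊s * V⌋ / V * v i| ≤ 1 := by
        rw [← sub_mul, abs_mul]
        calc _ ≤ 1 / V * V := mul_le_mul h1 (hv i) (abs_nonneg _) (by positivity)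
          _ = 1 := by field_simp
      have h3 := hn i
      rw [abs_le] at h2 h3
      rw [Finset.mem_Icc, Int.ceil_le, Int.le_floor]
      constructor <;> linarith
  refine ⟨(Finset.finite_toSet _).subset hsub, ?_⟩
  calc ((latticeTube v S ρ).ncard : ℝ) ≤ ((J.biUnion B).card : ℝ) := by
        rw [← Set.ncard_coe_finset]
        exact_mod_cast Set.ncard_le_ncard hsub (Finset.finite_toSet _)
    _ ≤ ∑ m ∈ J, ((B m).card : ℝ) := by exact_mod_cast Finset.card_biUnion_le
    _ ≤ ∑ m ∈ J, (2 * ρ + 3) ^ d := Finset.sum_le_sum fun m _ => hB m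
    _ = J.card * (2 * ρ + 3) ^ d := by rw [Finset.sum_const, nsmul_eq_mul]
    _ ≤ _ := by gcongr

theorem latticeTube_sub {d : ℕ} {v : Fin d → ℝ} {S ρ : ℝ} {m n : Fin d → ℤ}
    (hm : m ∈ latticeTube v S ρ) (hn : n ∈ latticeTube v S ρ) :
    m - n ∈ latticeTube v (2 * S) (2 * ρ) := by
  obtain ⟨s, hs, h⟩ := hm
  obtain ⟨t, ht, h'⟩ := hn
  refine ⟨s - t, (abs_sub _ _).trans (by linarith), fun i => ?_⟩
  have e : ((m - n) i : ℝ) - (s - t) * v i = (m i - s * v i) - (n i - t * v i) := by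
    simp only [Pi.sub_apply, Int.cast_sub]; ring
  rw [e]
  exact (abs_sub _ _).trans (by linarith [h i, h' i])

/-- The counting function of a tube is log-convex in the dilation factor: the pairs `(x, y)` of
points of the tube map to `x + m y`, with fibres controlled by the tube shrunk by `2 / m`. -/
theorem ncard_latticeTube_sq_le {d : ℕ} (v : Fin d → ℝ) (S ρ : ℝ) (m : ℕ) (hm : 0 < m)
    (h1 : (latticeTube v S ρ).Finite)
    (h2 : (latticeTube v (2 * S / m) (2 * ρ / m)).Finite)
    (h3 : (latticeTube v ((m + 1) * S) ((m + 1) * ρ)).Finite) :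
    (latticeTube v S ρ).ncard ^ 2 ≤ (latticeTube v (2 * S / m) (2 * ρ / m)).ncard *
      (latticeTube v ((m + 1) * S) ((m + 1) * ρ)).ncard := by
  classical
  have hmr : (0 : ℝ) < m := by exact_mod_cast hm
  rw [Set.ncard_eq_toFinset_card _ h1, Set.ncard_eq_toFinset_card _ h2,
    Set.ncard_eq_toFinset_card _ h3, sq, ← Finset.card_product]
  refine Finset.card_le_mul_card_image_of_maps_to (f := fun p => p.1 + m • p.2) ?_ _ ?_
  · intro p hp
    obtain ⟨hx, hy⟩ := Finset.mem_product.1 hp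
    obtain ⟨s, hs, h⟩ := h1.mem_toFinset.1 hx
    obtain ⟨t, ht, h'⟩ := h1.mem_toFinset.1 hy
    refine h3.mem_toFinset.2 ⟨s + m * t, ?_, fun i => ?_⟩
    · refine (abs_add_le _ _).trans ?_
      rw [abs_mul, abs_of_pos hmr]
      nlinarith
    · have e : ((p.1 + m • p.2) i : ℝ) - (s + m * t) * v i
          = (p.1 i - s * v i) + m * (p.2 i - t * v i) := by
        have e' : (m • p.2) i = (m : ℤ) * p.2 i := by rw [Pi.smul_apply, nsmul_eq_mul]
        rw [Pi.add_apply, e']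
        push_cast
        ring
      rw [e]
      refine (abs_add_le _ _).trans ?_
      rw [abs_mul, abs_of_pos hmr]
      nlinarith [h i, h' i]
  · intro z _
    by_cases hne : ((h1.toFinset ×ˢ h1.toFinset).filter fun p => p.1 + m • p.2 = z).Nonempty
    · obtain ⟨p₀, hp₀⟩ := hne
      obtain ⟨hp₀, hz₀⟩ := Finset.mem_filter.1 hp₀
      obtain ⟨hx₀, hy₀⟩ := Finset.mem_product.1 hp₀
      -- On a fibre `x + m y` is constant, so `y - y₀ = (x₀ - x)/m`. The difference `x₀ - x` lies in
      -- the doubled tube, hence `y - y₀` lies in that tube divided by `m`.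
      refine Finset.card_le_card_of_injOn (fun p => p.2 - p₀.2) ?_ ?_
      · intro p hp
        obtain ⟨hp, hz⟩ := Finset.mem_filter.1 (Finset.mem_coe.1 hp)
        obtain ⟨hx, hy⟩ := Finset.mem_product.1 hp
        obtain ⟨s, hs, h⟩ := latticeTube_sub (h1.mem_toFinset.1 hx₀) (h1.mem_toFinset.1 hx)
        refine Finset.mem_coe.2 (h2.mem_toFinset.2 ⟨s / m, ?_, fun i => ?_⟩)
        · rw [abs_div, abs_of_pos hmr]; gcongr
        · have e0 : p₀.1 i + m * p₀.2 i = p.1 i + m * p.2 i := by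
            have := congrFun (hz₀.trans hz.symm) i
            simpa using this
          have e1 : (p₀.1 i : ℝ) + m * p₀.2 i = p.1 i + m * p.2 i := by exact_mod_cast e0
          have e : ((p.2 - p₀.2) i : ℝ) - s / m * v i = (((p₀.1 - p.1) i : ℝ) - s * v i) / m := by
            simp only [Pi.sub_apply, Int.cast_sub]
            field_simp
            linarith
          rw [e, abs_div, abs_of_pos hmr]
          gcongr
          exact h i
      · intro p hp q hq hpq
        obtain ⟨-, hz⟩ := Finset.mem_filter.1 (Finset.mem_coe.1 hp)
        obtain ⟨-, hz'⟩ := Finset.mem_filter.1 (Finset.mem_coe.1 hq)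
        have e2 : p.2 = q.2 := sub_left_injective hpq
        refine Prod.ext ?_ e2
        have := hz.trans hz'.symm
        rw [e2] at this
        exact add_right_cancel this
    · rw [Finset.not_nonempty_iff_eq_empty.1 hne]; simp

/-! ### Probability that a lattice point is near the line through `Hζ`. -/

/-- Fubini in the coordinate `x i`: with the others frozen, the condition confines it to an interval
of length `2ε/|c|`, while membership in `A` is unaffected. -/
theorem pi_slice_le {ι : Type*} [Fintype ι] [DecidableEq ι] (i : ι) (c ε : ℝ) (hc : c ≠ 0)
    (g : (ι → ℝ) → ℝ) (hg : Measurable g) (hgi : ∀ x t, g (Function.update x i t) = g x)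
    (A : Set (ι → ℝ)) (hA : MeasurableSet A) (hAi : ∀ x t, Function.update x i t ∈ A ↔ x ∈ A) :
    Measure.pi (fun _ : ι => volume.restrict (Set.Icc (-1 : ℝ) 2))
        (A ∩ {x | |g x - c * x i| ≤ ε}) ≤
      ENNReal.ofReal (2 * ε / |c|) *
        Measure.pi (fun _ : ι => volume.restrict (Set.Icc (-1 : ℝ) 2)) A := by
  have hB : MeasurableSet {x : ι → ℝ | |g x - c * x i| ≤ ε} :=
    measurableSet_le (by fun_prop) measurable_const
  rw [← lintegral_indicator_one hA, ← lintegral_indicator_one (hA.inter hB),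
    ← lintegral_const_mul _ (measurable_one.indicator hA)]
  have hm1 : Measurable ((A ∩ {x | |g x - c * x i| ≤ ε}).indicator (1 : (ι → ℝ) → ENNReal)) :=
    measurable_one.indicator (hA.inter hB)
  have hm2 : Measurable fun x => ENNReal.ofReal (2 * ε / |c|) *
      A.indicator (1 : (ι → ℝ) → ENNReal) x := (measurable_one.indicator hA).const_mul _
  refine lintegral_le_of_lmarginal_le {i} hm1 hm2 fun x => ?_
  rw [lmarginal_singleton, lmarginal_singleton]
  by_cases hx : x ∈ A
  · have h1 : ∀ t, A.indicator (1 : (ι → ℝ) → ENNReal) (Function.update x i t) = 1 := fun t =>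
      Set.indicator_of_mem ((hAi x t).2 hx) _
    simp only [h1, mul_one]
    have hmt : MeasurableSet {t : ℝ | |g x - t * c| ≤ ε} :=
      measurableSet_le (by fun_prop) measurable_const
    calc _ ≤ ∫⁻ t in Set.Icc (-1 : ℝ) 2, {t : ℝ | |g x - t * c| ≤ ε}.indicator 1 t := by
          refine lintegral_mono fun t => ?_
          by_cases ht : |g x - t * c| ≤ ε
          · rw [Set.indicator_of_mem (s := {t : ℝ | |g x - t * c| ≤ ε}) ht]
            exact Set.indicator_le_self' (fun _ _ => zero_le) _
          · rw [Set.indicator_of_notMem]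
            · exact zero_le
            · rintro ⟨-, h⟩
              refine ht ?_
              have : |g (Function.update x i t) - c * Function.update x i t i| ≤ ε := h
              rwa [hgi, Function.update_self, mul_comm] at this
      _ ≤ ∫⁻ t, {t : ℝ | |g x - t * c| ≤ ε}.indicator 1 t := setLIntegral_le_lintegral _ _
      _ ≤ ENNReal.ofReal (2 * ε / |c|) := by
          rw [lintegral_indicator_one hmt]
          exact volume_slice_le _ _ _ _ (abs_pos.2 hc) le_rfl
      -- The factor `3` is the length of `[-1, 2]`, which the marginal of `A` carries on the
      -- right-hand side.
      _ ≤ ENNReal.ofReal (2 * ε / |c|) * 3 := le_mul_of_one_le_right' (by norm_num)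
      _ = _ := by
          rw [setLIntegral_const, Real.volume_Icc]
          norm_num
  · have h1 : ∀ t, (A ∩ {x | |g x - c * x i| ≤ ε}).indicator (1 : (ι → ℝ) → ENNReal)
        (Function.update x i t) = 0 := fun t =>
      Set.indicator_of_notMem (fun h => hx ((hAi x t).1 h.1)) _
    simp only [h1, lintegral_zero]
    exact zero_le

/-- Lebesgue measure on the symmetric matrices with entries in `[-1, 2]`. -/
noncomputable def symBoxMeasure (d : ℕ) : Measure (Sym2 (Fin d) → ℝ) :=
  Measure.pi fun _ => volume.restrict (Set.Icc (-1 : ℝ) 2)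

theorem symBoxMeasure_univ (d : ℕ) :
    symBoxMeasure d Set.univ = ENNReal.ofReal (3 ^ Fintype.card (Sym2 (Fin d))) := by
  rw [symBoxMeasure, Measure.pi_univ]
  simp only [Measure.restrict_apply_univ, Real.volume_Icc, Finset.prod_const, Finset.card_univ]
  rw [ENNReal.ofReal_pow (by norm_num)]
  norm_num

/-- The vector `H ζ`. -/
def symApply {d : ℕ} (h : Sym2 (Fin d) → ℝ) (ζ : Fin d → ℤ) (j : Fin d) : ℝ :=
  ∑ l, h s(j, l) * ζ l

theorem measurable_symApply {d : ℕ} (ζ : Fin d → ℤ) (j : Fin d) :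
    Measurable fun h : Sym2 (Fin d) → ℝ => symApply h ζ j := by
  unfold symApply
  fun_prop

theorem symApply_update {d : ℕ} (h : Sym2 (Fin d) → ℝ) (ζ : Fin d → ℤ) (j : Fin d)
    (p : Sym2 (Fin d)) (hp : j ∉ p) (t : ℝ) :
    symApply (Function.update h p t) ζ j = symApply h ζ j := by
  refine Finset.sum_congr rfl fun l _ => ?_
  rw [Function.update_of_ne]
  rintro rfl
  exact hp (Sym2.mem_mk_left _ _)

theorem symApply_eq_add_update {d : ℕ} (h : Sym2 (Fin d) → ℝ) (ζ : Fin d → ℤ) (j k : Fin d) :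
    symApply h ζ j = h s(j, k) * ζ k + symApply (Function.update h s(j, k) 0) ζ j := by
  rw [symApply, symApply, ← Finset.add_sum_erase _ _ (Finset.mem_univ k),
    ← Finset.add_sum_erase (a := k) (f := fun l => Function.update h s(j, k) 0 s(j, l) * (ζ l : ℝ))
      _ (Finset.mem_univ k)]
  rw [Function.update_self, zero_mul, zero_add]
  congr 1
  refine Finset.sum_congr rfl fun l hl => ?_
  rw [Function.update_of_ne]
  intro h'
  exact (Finset.ne_of_mem_erase hl) (Sym2.congr_right.1 h')

/-- Symmetry makes the rows of `H` dependent, but row `j` contains the entry `h_{jk}` with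
coefficient `ζ k`, and apart from row `j` only row `k` contains it. Integrating out these `d`
entries in a suitable order gains one factor per row. -/
theorem symBoxMeasure_forall_le {d : ℕ} (ζ n : Fin d → ℤ) (s ε : ℝ) (k : Fin d)
    (hs : s * ζ k ≠ 0) :
    symBoxMeasure d {h | ∀ j, |(n j : ℝ) - s * symApply h ζ j| ≤ ε} ≤
      ENNReal.ofReal (2 * ε / |s * ζ k|) ^ d * symBoxMeasure d Set.univ := by
  classical
  let D : Fin d → Set (Sym2 (Fin d) → ℝ) := fun j => {h | |(n j : ℝ) - s * symApply h ζ j| ≤ ε}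
  have hD : ∀ j, MeasurableSet (D j) := fun j =>
    measurableSet_le (((measurable_symApply ζ j).const_mul s).const_sub _).abs measurable_const
  have step : ∀ (J : Finset (Fin d)) (j : Fin d), (∀ i ∈ J, i ∉ s(j, k)) →
      symBoxMeasure d ((⋂ i ∈ J, D i) ∩ D j) ≤
        ENNReal.ofReal (2 * ε / |s * ζ k|) * symBoxMeasure d (⋂ i ∈ J, D i) := by
    intro J j hJ
    have e : D j = {h | |((n j : ℝ) - s * symApply (Function.update h s(j, k) 0) ζ j)
        - (s * ζ k) * h s(j, k)| ≤ ε} := by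
      ext h
      simp only [D, Set.mem_ofPred_eq]
      rw [symApply_eq_add_update h ζ j k]
      ring_nf
    rw [e]
    refine pi_slice_le s(j, k) (s * ζ k) ε hs _ ?_ ?_ _ ?_ ?_
    · have : Measurable fun h : Sym2 (Fin d) → ℝ => Function.update h s(j, k) 0 :=
        measurable_update_left
      exact (((measurable_symApply ζ j).comp this).const_mul s).const_sub _
    · intro x t
      simp only [Function.update_idem]
    · exact Finset.measurableSet_biInter _ fun i _ => hD i
    · intro x t
      simp only [Set.mem_iInter, D, Set.mem_ofPred_eq]
      refine forall₂_congr fun i hi => ?_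
      rw [symApply_update _ _ _ _ (hJ i hi)]
  have key : ∀ J : Finset (Fin d), k ∉ J → symBoxMeasure d (⋂ i ∈ J, D i) ≤
      ENNReal.ofReal (2 * ε / |s * ζ k|) ^ J.card * symBoxMeasure d Set.univ := by
    intro J
    induction J using Finset.induction_on with
    | empty => intro _; simp
    | insert j J hj ih =>
      intro hk
      rw [Finset.mem_insert, not_or] at hk
      rw [Finset.set_biInter_insert, Set.inter_comm, Finset.card_insert_of_notMem hj, pow_succ',
        mul_assoc]
      refine (step J j fun i hi => ?_).trans (mul_le_mul_right (ih hk.2) _)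
      rw [Sym2.mem_iff, not_or]
      exact ⟨fun h => hj (h ▸ hi), fun h => hk.2 (h ▸ hi)⟩
  -- Row `k` has to be peeled off first, using `h_{kk}`, which no other row contains. Once it is
  -- gone, each remaining row `j` is the only one containing `h_{jk}`.
  have e : {h | ∀ j, |(n j : ℝ) - s * symApply h ζ j| ≤ ε}
      = (⋂ i ∈ Finset.univ.erase k, D i) ∩ D k := by
    ext h
    simp only [Set.mem_inter_iff, Set.mem_iInter, Finset.mem_erase, Finset.mem_univ, and_true, D,
      Set.mem_ofPred_eq]
    refine ⟨fun h => ⟨fun i _ => h i, h k⟩, fun h j => ?_⟩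
    by_cases hj : j = k
    · exact hj ▸ h.2
    · exact h.1 j hj
  have hd : d = (Finset.univ.erase k).card + 1 := by
    rw [Finset.card_erase_of_mem (Finset.mem_univ k)]
    have := k.pos
    simp; omega
  rw [e]
  refine (step _ k fun i hi => ?_).trans ?_
  · have := Finset.ne_of_mem_erase hi
    simpa [Sym2.mem_iff] using this
  · have hpow : ENNReal.ofReal (2 * ε / |s * ζ k|) ^ d = ENNReal.ofReal (2 * ε / |s * ζ k|) *
        ENNReal.ofReal (2 * ε / |s * ζ k|) ^ (Finset.univ.erase k).card := by
      rw [← pow_succ']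
      exact congrArg (ENNReal.ofReal (2 * ε / |s * ζ k|) ^ ·) hd
    rw [hpow, mul_assoc]
    exact mul_le_mul_right (key _ (Finset.notMem_erase _ _)) _

/-- A finite union of slabs containing the matrices near the identity for which `n` is within
`ρ` of the line through `H ζ`. -/
def nearLine {d : ℕ} (ζ n : Fin d → ℤ) (ρ : ℝ) : Set (Sym2 (Fin d) → ℝ) :=
  ⋃ m ∈ (Finset.Icc ⌈-(3 * latticeHeight n / ρ)⌉ ⌊3 * latticeHeight n / ρ⌋).filter
      fun m : ℤ => (latticeHeight n : ℝ) ≤ 4 * ρ * |(m : ℝ)|,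
    {h | ∀ j, |(n j : ℝ) - m * ρ / latticeHeight ζ * symApply h ζ j| ≤ 4 * ρ}

theorem measurableSet_nearLine {d : ℕ} (ζ n : Fin d → ℤ) (ρ : ℝ) :
    MeasurableSet (nearLine ζ n ρ) := by
  refine Finset.measurableSet_biUnion _ fun m _ => ?_
  refine measurableSet_setOfPred.2 (Measurable.forall fun j => measurableSet_setOfPred.1 ?_)
  exact measurableSet_le (((measurable_symApply ζ j).const_mul _).const_sub _).abs measurable_const

/-- There are `≲ |n|/ρ` discretized parameters, each with probability `≲ (ρ/|n|)^d`. The union bound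
costs one power and leaves `d - 1`. -/
theorem symBoxMeasure_nearLine_le {d : ℕ} (hd : 0 < d) (ζ n : Fin d → ℤ) (hζ : ζ ≠ 0)
    (hn : n ≠ 0) (ρ : ℝ) (hρ : 0 < ρ) (hρ1 : ρ ≤ 1) :
    symBoxMeasure d (nearLine ζ n ρ) ≤
      ENNReal.ofReal (7 * 32 ^ d * 3 ^ Fintype.card (Sym2 (Fin d)) *
        (ρ / latticeHeight n) ^ (d - 1)) := by
  obtain ⟨k, hk⟩ := exists_abs_eq_latticeHeight hζ
  have hZ : (0 : ℝ) < latticeHeight ζ := by exact_mod_cast latticeHeight_pos hζ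
  have hA : (1 : ℝ) ≤ latticeHeight n := by exact_mod_cast latticeHeight_pos hn
  set A : ℝ := (latticeHeight n : ℝ)
  have hA0 : 0 < A := by linarith
  refine (measure_biUnion_finset_le _ _).trans ?_
  set I := (Finset.Icc ⌈-(3 * A / ρ)⌉ ⌊3 * A / ρ⌋).filter fun m : ℤ => A ≤ 4 * ρ * |(m : ℝ)|
  have hI : (I.card : ℝ) ≤ 7 * (A / ρ) := by
    have h0 : 0 ≤ 3 * A / ρ := by positivity
    have h1 : 1 ≤ A / ρ := by rw [le_div_iff₀ hρ]; linarith
    calc (I.card : ℝ) ≤ ((Finset.Icc ⌈-(3 * A / ρ)⌉ ⌊3 * A / ρ⌋).card : ℝ) := by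
          exact_mod_cast Finset.card_filter_le _ _
      _ ≤ 3 * A / ρ - -(3 * A / ρ) + 1 := card_Icc_ceil_floor_le _ _ (by linarith)
      _ ≤ 7 * (A / ρ) := by rw [mul_div_assoc]; linarith
  have hterm : ∀ m ∈ I, symBoxMeasure d
      {h | ∀ j, |(n j : ℝ) - m * ρ / latticeHeight ζ * symApply h ζ j| ≤ 4 * ρ} ≤
      ENNReal.ofReal ((32 * ρ / A) ^ d * 3 ^ Fintype.card (Sym2 (Fin d))) := by
    intro m hm
    have hm1 : A ≤ 4 * ρ * |(m : ℝ)| := (Finset.mem_filter.1 hm).2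
    have hm0 : 0 < |(m : ℝ)| := by
      by_contra h
      have : |(m : ℝ)| = 0 := le_antisymm (not_lt.1 h) (abs_nonneg _)
      rw [this] at hm1; linarith
    have habs : |m * ρ / latticeHeight ζ * ζ k| = |(m : ℝ)| * ρ := by
      rw [abs_mul, hk, abs_div, abs_mul, abs_of_pos hρ, abs_of_pos hZ]
      field_simp
    have hne : (m * ρ / latticeHeight ζ * ζ k : ℝ) ≠ 0 := by
      rw [← abs_pos, habs]; positivity
    refine (symBoxMeasure_forall_le ζ n _ _ k hne).trans ?_
    rw [symBoxMeasure_univ, habs, ← ENNReal.ofReal_pow (by positivity),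
      ← ENNReal.ofReal_mul (by positivity)]
    refine ENNReal.ofReal_le_ofReal ?_
    gcongr ?_ ^ _ * _
    rw [div_le_div_iff₀ (by positivity) hA0]
    nlinarith
  refine (Finset.sum_le_sum hterm).trans ?_
  rw [Finset.sum_const, nsmul_eq_mul, ← ENNReal.ofReal_natCast, ← ENNReal.ofReal_mul (by positivity)]
  refine ENNReal.ofReal_le_ofReal ?_
  obtain ⟨e, rfl⟩ : ∃ e, d = e + 1 := ⟨d - 1, by omega⟩
  calc _ ≤ 7 * (A / ρ) * ((32 * ρ / A) ^ (e + 1) * 3 ^ Fintype.card (Sym2 (Fin (e + 1)))) := by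
        gcongr
    _ = _ := by
        rw [mul_div_assoc, mul_pow, pow_succ (ρ / A)]
        simp only [Nat.add_sub_cancel]
        field_simp

/-! ### Matrices near the identity: from tubes to `nearLine`. -/

/-- This fixes the admissible radius: `d` entries, each off by at most `1/(2(d+1))`, perturb `ζ` by
at most half its height. -/
theorem symApply_bounds {d : ℕ} (h : Sym2 (Fin d) → ℝ) (ζ : Fin d → ℤ)
    (hh : ∀ i j : Fin d, |symMatrix h i j - (1 : Matrix (Fin d) (Fin d) ℝ) i j| ≤
      1 / (2 * (d + 1))) (j : Fin d) :
    |symApply h ζ j - ζ j| ≤ latticeHeight ζ / 2 := by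
  have e : symApply h ζ j - ζ j
      = ∑ l, (symMatrix h j l - (1 : Matrix (Fin d) (Fin d) ℝ) j l) * ζ l := by
    simp only [sub_mul, Finset.sum_sub_distrib]
    simp [symApply, symMatrix, Matrix.one_apply]
  rw [e]
  calc _ ≤ ∑ l, |(symMatrix h j l - (1 : Matrix (Fin d) (Fin d) ℝ) j l) * ζ l| :=
        Finset.abs_sum_le_sum_abs _ _
    _ ≤ ∑ _l : Fin d, 1 / (2 * (d + 1)) * (latticeHeight ζ : ℝ) := by
        refine Finset.sum_le_sum fun l _ => ?_
        rw [abs_mul]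
        exact mul_le_mul (hh j l) (abs_le_latticeHeight ζ l) (abs_nonneg _) (by positivity)
    _ = d / (d + 1) * (latticeHeight ζ / 2) := by
        rw [Finset.sum_const, Finset.card_univ, Fintype.card_fin, nsmul_eq_mul]
        field_simp
    _ ≤ 1 * (latticeHeight ζ / 2) := by
        gcongr
        rw [div_le_one (by positivity)]; linarith
    _ = _ := one_mul _

theorem abs_symApply_le {d : ℕ} (h : Sym2 (Fin d) → ℝ) (ζ : Fin d → ℤ)
    (hh : ∀ i j : Fin d, |symMatrix h i j - (1 : Matrix (Fin d) (Fin d) ℝ) i j| ≤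
      1 / (2 * (d + 1))) (j : Fin d) :
    |symApply h ζ j| ≤ 3 / 2 * latticeHeight ζ := by
  have h1 := symApply_bounds h ζ hh j
  have h2 := abs_le_latticeHeight ζ j
  rw [abs_le] at *
  constructor <;> linarith

theorem exists_le_abs_symApply {d : ℕ} (h : Sym2 (Fin d) → ℝ) (ζ : Fin d → ℤ) (hζ : ζ ≠ 0)
    (hh : ∀ i j : Fin d, |symMatrix h i j - (1 : Matrix (Fin d) (Fin d) ℝ) i j| ≤
      1 / (2 * (d + 1))) :
    ∃ k, (latticeHeight ζ : ℝ) / 2 ≤ |symApply h ζ k| := by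
  obtain ⟨k, hk⟩ := exists_abs_eq_latticeHeight hζ
  refine ⟨k, ?_⟩
  have h1 := symApply_bounds h ζ hh k
  have h2 := abs_sub_abs_le_abs_sub (ζ k : ℝ) (symApply h ζ k)
  rw [abs_sub_comm] at h2
  linarith

/-- Since `|Hζ|` is comparable to `|ζ|`, a nonzero tube point forces `|s||ζ|` to be comparable to
`|n|`. Rounding `s` to the grid of step `ρ/|ζ|` then costs only a multiple of `ρ`. -/
theorem mem_nearLine_of_mem_latticeTube {d : ℕ} (h : Sym2 (Fin d) → ℝ) (ζ n : Fin d → ℤ)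
    (hh : ∀ i j : Fin d, |symMatrix h i j - (1 : Matrix (Fin d) (Fin d) ℝ) i j| ≤
      1 / (2 * (d + 1))) (hζ : ζ ≠ 0) (hn : n ≠ 0) (S ρ : ℝ) (hρ : 0 < ρ) (hρ1 : ρ ≤ 1 / 16)
    (hmem : n ∈ latticeTube (symApply h ζ) S ρ) :
    h ∈ nearLine ζ n ρ ∧ (latticeHeight n : ℝ) ≤ 2 * S * latticeHeight ζ := by
  obtain ⟨s, hs, hsn⟩ := hmem
  have hup := abs_symApply_le h ζ hh
  obtain ⟨k, hk⟩ := exists_le_abs_symApply h ζ hζ hh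
  have hZ : (0 : ℝ) < latticeHeight ζ := by exact_mod_cast latticeHeight_pos hζ
  have hA : (1 : ℝ) ≤ latticeHeight n := by exact_mod_cast latticeHeight_pos hn
  obtain ⟨i, hi⟩ := exists_abs_eq_latticeHeight hn
  have hnk := abs_le_latticeHeight n k
  set A : ℝ := (latticeHeight n : ℝ) with hAdef
  set Z : ℝ := (latticeHeight ζ : ℝ) with hZdef
  have habs := abs_nonneg s
  -- As `A ≥ 1`, the error `ρ ≤ 1/16` is at most `A/16`: `(15/16) · (2/3) = 5/8` here, and `2 ·
  -- (17/16) = 17/8` for the upper bound.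
  have hlow : 5 / 8 * A ≤ |s| * Z := by
    have h1 := hsn i
    have h2 : |(n i : ℝ)| ≤ |(n i : ℝ) - s * symApply h ζ i| + |s * symApply h ζ i| := by
      simpa using abs_add_le ((n i : ℝ) - s * symApply h ζ i) (s * symApply h ζ i)
    rw [abs_mul] at h2
    have h3 := mul_le_mul_of_nonneg_left (hup i) habs
    nlinarith
  have hhigh : |s| * Z ≤ 17 / 8 * A := by
    have h1 := hsn k
    have h2 : |s * symApply h ζ k| ≤ |(n k : ℝ) - s * symApply h ζ k| + |(n k : ℝ)| := by
      have := abs_sub_abs_le_abs_sub (s * symApply h ζ k) (n k : ℝ)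
      rw [abs_sub_comm] at this
      linarith
    rw [abs_mul] at h2
    have h3 := mul_le_mul_of_nonneg_left hk habs
    nlinarith
  refine ⟨?_, by nlinarith⟩
  set m : ℤ := ⌊s * Z / ρ⌋ with hm
  have hmρ : |s * Z - m * ρ| ≤ ρ := by
    have h1 := Int.floor_le (s * Z / ρ)
    have h2 := Int.lt_floor_add_one (s * Z / ρ)
    rw [le_div_iff₀ hρ] at h1
    rw [div_lt_iff₀ hρ] at h2
    rw [abs_le]; constructor <;> linarith
  have hsZ : |s * Z| = |s| * Z := by rw [abs_mul, abs_of_pos hZ]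
  have hmabs : |(m : ℝ) * ρ| = |(m : ℝ)| * ρ := by rw [abs_mul, abs_of_pos hρ]
  have hm1 : |(m : ℝ)| * ρ ≤ 3 * A := by
    have := abs_sub_abs_le_abs_sub (m * ρ : ℝ) (s * Z)
    rw [abs_sub_comm] at this
    linarith
  have hm2 : A ≤ 4 * ρ * |(m : ℝ)| := by
    have := abs_sub_abs_le_abs_sub (s * Z) (m * ρ : ℝ)
    linarith
  have hm3 : |(m : ℝ)| ≤ 3 * A / ρ := by rwa [le_div_iff₀ hρ]
  refine Set.mem_biUnion (x := m) (Finset.mem_coe.2 (Finset.mem_filter.2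
    ⟨Finset.mem_Icc.2 ⟨Int.ceil_le.2 (abs_le.1 hm3).1, Int.le_floor.2 (abs_le.1 hm3).2⟩, hm2⟩)) ?_
  intro j
  -- Rounding costs `3ρ/2`; with the original `ρ` the total stays below the allowed `4ρ`.
  have h1 : |s * symApply h ζ j - m * ρ / Z * symApply h ζ j| ≤ 3 / 2 * ρ := by
    have e : s * symApply h ζ j - m * ρ / Z * symApply h ζ j
        = (s * Z - m * ρ) / Z * symApply h ζ j := by field_simp
    rw [e, abs_mul, abs_div, abs_of_pos hZ]
    calc _ ≤ ρ / Z * (3 / 2 * Z) := mul_le_mul (by gcongr) (hup j) (abs_nonneg _) (by positivity)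
      _ = _ := by field_simp
  have h2 := hsn j
  rw [abs_le] at *
  constructor <;> linarith

/-! ### First moments and the almost sure bound. -/

/-- The number of nonzero `n` of sup-norm at most `T` whose slabs `nearLine ζ n ρ` contain `h`. -/
noncomputable def nearCount {d : ℕ} (ζ : Fin d → ℤ) (T : ℕ) (ρ : ℝ) (h : Sym2 (Fin d) → ℝ) :
    ENNReal :=
  ∑ n ∈ (latticeBox d T).filter (· ≠ 0), (nearLine ζ n ρ).indicator 1 h

theorem measurable_nearCount {d : ℕ} (ζ : Fin d → ℤ) (T : ℕ) (ρ : ℝ) :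
    Measurable (nearCount ζ T ρ) :=
  Finset.measurable_fun_sum _ fun n _ => measurable_one.indicator (measurableSet_nearLine ζ n ρ)

theorem nearCount_mono {d : ℕ} (ζ : Fin d → ℤ) {T T' : ℕ} (hT : T ≤ T') (ρ : ℝ)
    (h : Sym2 (Fin d) → ℝ) : nearCount ζ T ρ h ≤ nearCount ζ T' ρ h := by
  refine Finset.sum_le_sum_of_subset fun n hn => ?_
  rw [Finset.mem_filter, mem_latticeBox] at hn ⊢
  exact ⟨hn.1.trans hT, hn.2⟩

/-- A constant bounding the density of `nearLine` events. -/
noncomputable def nearConst (d : ℕ) : ℝ :=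
  2 * d * 3 ^ (d - 1) * (7 * 32 ^ d * 3 ^ Fintype.card (Sym2 (Fin d)))

theorem nearConst_nonneg (d : ℕ) : 0 ≤ nearConst d := by unfold nearConst; positivity

/-- The shell of height `r` has `≲ r^(d-1)` points, each of probability `≲ (ρ/r)^(d-1)`, so every
shell contributes the same amount `ρ^(d-1)`. -/
theorem lintegral_nearCount_le {d : ℕ} (hd : 0 < d) (ζ : Fin d → ℤ) (hζ : ζ ≠ 0) (T : ℕ) (ρ : ℝ)
    (hρ : 0 < ρ) (hρ1 : ρ ≤ 1) :
    ∫⁻ h, nearCount ζ T ρ h ∂symBoxMeasure d ≤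
      ENNReal.ofReal (nearConst d * (T * ρ ^ (d - 1))) := by
  unfold nearCount
  rw [lintegral_finsetSum _ fun n _ =>
    measurable_one.indicator (measurableSet_nearLine ζ n ρ)]
  set c : ℝ := 7 * 32 ^ d * 3 ^ Fintype.card (Sym2 (Fin d)) with hc
  have hc0 : 0 ≤ c := by positivity
  calc _ ≤ ∑ n ∈ (latticeBox d T).filter (· ≠ 0),
        ENNReal.ofReal (c * (ρ / latticeHeight n) ^ (d - 1)) := by
        refine Finset.sum_le_sum fun n hn => ?_
        rw [lintegral_indicator_one (measurableSet_nearLine ζ n ρ)]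
        exact symBoxMeasure_nearLine_le hd ζ n hζ (Finset.mem_filter.1 hn).2 ρ hρ hρ1
    _ = ENNReal.ofReal (∑ n ∈ (latticeBox d T).filter (· ≠ 0),
        c * (ρ / latticeHeight n) ^ (d - 1)) :=
        (ENNReal.ofReal_sum_of_nonneg fun n _ => by positivity).symm
    _ ≤ _ := by
        refine ENNReal.ofReal_le_ofReal ?_
        refine (sum_latticeBox_le d T (fun r => c * (ρ / r) ^ (d - 1))
          fun r => by positivity).trans ?_
        have : ∀ r ∈ Finset.Icc 1 T, (r : ℝ) ^ (d - 1) * (c * (ρ / r) ^ (d - 1))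
            = c * ρ ^ (d - 1) := by
          intro r hr
          have hr : (r : ℝ) ≠ 0 := by
            have := (Finset.mem_Icc.1 hr).1
            positivity
          rw [div_pow]
          field_simp
        rw [Finset.sum_congr rfl this, Finset.sum_const, Nat.card_Icc, nsmul_eq_mul,
          Nat.add_sub_cancel, nearConst]
        apply le_of_eq
        ring

/-- The summand `1` is the origin. It lies in every tube when `S ≥ 0`, so no averaging can remove
it. -/
theorem ncard_latticeTube_le_nearCount {d : ℕ} (h : Sym2 (Fin d) → ℝ) (ζ : Fin d → ℤ)
    (hh : ∀ i j : Fin d, |symMatrix h i j - (1 : Matrix (Fin d) (Fin d) ℝ) i j| ≤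
      1 / (2 * (d + 1))) (hζ : ζ ≠ 0) (S ρ : ℝ) (hρ : 0 < ρ) (hρ1 : ρ ≤ 1 / 16)
    (T : ℕ) (hT : 2 * S * latticeHeight ζ < T + 1) :
    ((latticeTube (symApply h ζ) S ρ).ncard : ENNReal) ≤ 1 + nearCount ζ T ρ h := by
  classical
  set F := ((latticeBox d T).filter (· ≠ 0)).filter fun n => h ∈ nearLine ζ n ρ with hF
  have hsub : latticeTube (symApply h ζ) S ρ ⊆ (insert 0 F : Finset (Fin d → ℤ)) := by
    intro n hn
    rw [Finset.mem_coe, Finset.mem_insert]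
    by_cases hn0 : n = 0
    · exact Or.inl hn0
    · obtain ⟨h1, h2⟩ := mem_nearLine_of_mem_latticeTube h ζ n hh hζ hn0 S ρ hρ hρ1 hn
      refine Or.inr (Finset.mem_filter.2 ⟨Finset.mem_filter.2 ⟨mem_latticeBox.2 ?_, hn0⟩, h1⟩)
      have : (latticeHeight n : ℝ) < ((T + 1 : ℕ) : ℝ) := by push_cast; linarith
      exact Nat.lt_succ_iff.1 (by exact_mod_cast this)
  have hcard : (latticeTube (symApply h ζ) S ρ).ncard ≤ 1 + F.card := by
    calc _ ≤ (insert 0 F).card := by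
          rw [← Set.ncard_coe_finset]
          exact Set.ncard_le_ncard hsub (Finset.finite_toSet _)
      _ ≤ F.card + 1 := Finset.card_insert_le _ _
      _ = _ := add_comm _ _
  have hcount : nearCount ζ T ρ h = F.card := by
    rw [hF, Finset.card_filter, nearCount]
    push_cast
    refine Finset.sum_congr rfl fun n _ => ?_
    rw [Set.indicator_apply, Pi.one_apply]
  rw [hcount]
  exact_mod_cast hcard

/-- The total contribution of the short dual vectors at the scale `R`, `δ`. -/
noncomputable def badSum {d : ℕ} (R : ℕ) (δ : ℝ) (h : Sym2 (Fin d) → ℝ) : ENNReal :=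
  ∑ ζ ∈ (latticeBox d R).filter (· ≠ 0),
    (ENNReal.ofReal (1 / (latticeHeight ζ * R ^ (d - 1))) *
        nearCount ζ ⌊latticeHeight ζ / δ⌋₊ (1 / (12 * d * R)) h +
      nearCount ζ ⌊1 / δ⌋₊ (1 / (6 * d * R * latticeHeight ζ)) h)

theorem measurable_badSum {d : ℕ} (R : ℕ) (δ : ℝ) :
    Measurable (badSum R δ : (Sym2 (Fin d) → ℝ) → ENNReal) :=
  Finset.measurable_fun_sum _ fun ζ _ =>
    ((measurable_nearCount ζ _ _).const_mul _).add (measurable_nearCount ζ _ _)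

/-- Because of this monotonicity it suffices to control each scale `R` at the threshold `δ =
R^(2-d+κ)`. -/
theorem badSum_anti {d : ℕ} (R : ℕ) {δ δ' : ℝ} (hδ : 0 < δ) (hδ' : δ ≤ δ')
    (h : Sym2 (Fin d) → ℝ) : badSum R δ' h ≤ badSum R δ h := by
  refine Finset.sum_le_sum fun ζ _ => add_le_add (mul_le_mul_right (nearCount_mono ζ ?_ _ h) _)
    (nearCount_mono ζ ?_ _ h)
  · exact Nat.floor_le_floor (by gcongr)
  · exact Nat.floor_le_floor (by gcongr)

/-- With `Z = |ζ|`, the first term has mean `≲ R^(-2(d-1))/δ` and the second `≲ (RZ)^(-(d-1))/δ`.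
Summed over the `≲ Z^(d-1)` points of each shell and the `R` shells, both give `R^(2-d)/δ`. The
weights in `badSum` are chosen for this balance. -/
theorem lintegral_badSum_le {d : ℕ} (hd : 0 < d) (R : ℕ) (hR : 0 < R) (δ : ℝ) (hδ : 0 < δ) :
    ∫⁻ h, badSum R δ h ∂symBoxMeasure d ≤
      ENNReal.ofReal (4 * d * 3 ^ (d - 1) * nearConst d * (1 / δ * (R / R ^ (d - 1)))) := by
  have hd1 : (1 : ℝ) ≤ d := by exact_mod_cast hd
  have hR1 : (1 : ℝ) ≤ R := by exact_mod_cast hR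
  have hc := nearConst_nonneg d
  unfold badSum
  rw [lintegral_finsetSum]
  swap
  · exact fun ζ _ => ((measurable_nearCount ζ _ _).const_mul _).add (measurable_nearCount ζ _ _)
  let f : ℕ → ℝ := fun r => nearConst d * (1 / δ * (1 / R ^ (d - 1))) *
    (1 / R ^ (d - 1) + 1 / r ^ (d - 1))
  have hf : ∀ r, 0 ≤ f r := fun r => by positivity
  calc _ ≤ ∑ ζ ∈ (latticeBox d R).filter (· ≠ 0), ENNReal.ofReal (f (latticeHeight ζ)) := by
        refine Finset.sum_le_sum fun ζ hζ => ?_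
        have hζ0 := (Finset.mem_filter.1 hζ).2
        have hZ : (1 : ℝ) ≤ latticeHeight ζ := by exact_mod_cast latticeHeight_pos hζ0
        set Z : ℝ := (latticeHeight ζ : ℝ)
        have hdR : 1 ≤ (d : ℝ) * R := one_le_mul_of_one_le_of_one_le hd1 hR1
        have hdRZ : 1 ≤ (d : ℝ) * R * Z := one_le_mul_of_one_le_of_one_le hdR hZ
        have h1 : (1 / (12 * d * R) : ℝ) ≤ 1 / R := by gcongr; nlinarith
        have h2 : (1 / (6 * d * R * Z) : ℝ) ≤ 1 / (R * Z) := by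
          gcongr
          have : (R : ℝ) * Z ≤ d * (R * Z) := le_mul_of_one_le_left (by positivity) hd1
          nlinarith
        have hR2 : (1 / R : ℝ) ≤ 1 := by rw [div_le_one (by positivity)]; exact hR1
        have hR3 : (1 / (R * Z) : ℝ) ≤ 1 := by
          rw [div_le_one (by positivity)]; exact one_le_mul_of_one_le_of_one_le hR1 hZ
        rw [lintegral_add_left ((measurable_nearCount ζ _ _).const_mul _),
          lintegral_const_mul _ (measurable_nearCount ζ _ _)]
        refine (add_le_add (mul_le_mul_right (lintegral_nearCount_le hd ζ hζ0 _ _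
          (by positivity) (h1.trans hR2)) _) (lintegral_nearCount_le hd ζ hζ0 _ _
          (by positivity) (h2.trans hR3))).trans ?_
        rw [← ENNReal.ofReal_mul (by positivity), ← ENNReal.ofReal_add (by positivity)
          (by positivity)]
        refine ENNReal.ofReal_le_ofReal ?_
        calc _ ≤ 1 / (Z * R ^ (d - 1)) * (nearConst d * (Z / δ * (1 / R) ^ (d - 1))) +
              nearConst d * (1 / δ * (1 / (R * Z)) ^ (d - 1)) := by
              gcongr
              · exact Nat.floor_le (by positivity)
              · exact Nat.floor_le (by positivity)
          _ = f (latticeHeight ζ) := by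
              rw [show f (latticeHeight ζ) = nearConst d * (1 / δ * (1 / R ^ (d - 1))) *
                (1 / R ^ (d - 1) + 1 / Z ^ (d - 1)) from rfl]
              simp only [div_pow, one_pow, mul_pow]
              field_simp
    _ = ENNReal.ofReal (∑ ζ ∈ (latticeBox d R).filter (· ≠ 0), f (latticeHeight ζ)) :=
        (ENNReal.ofReal_sum_of_nonneg fun n _ => hf _).symm
    _ ≤ _ := by
        refine ENNReal.ofReal_le_ofReal ((sum_latticeBox_le d R f hf).trans ?_)
        have hterm : ∀ r ∈ Finset.Icc 1 R, (r : ℝ) ^ (d - 1) * f r ≤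
            nearConst d * (1 / δ * (1 / R ^ (d - 1))) * 2 := by
          intro r hr
          obtain ⟨hr1, hr2⟩ := Finset.mem_Icc.1 hr
          have hr0 : (0 : ℝ) < r := by exact_mod_cast hr1
          have : (r : ℝ) ^ (d - 1) * f r = nearConst d * (1 / δ * (1 / R ^ (d - 1))) *
              ((r / R : ℝ) ^ (d - 1) + 1) := by
            simp only [f, div_pow]
            field_simp
          rw [this]
          have h2 : (r / R : ℝ) ^ (d - 1) ≤ 1 := by
            refine pow_le_one₀ (by positivity) ?_
            rw [div_le_one (by positivity)]
            exact_mod_cast hr2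
          gcongr
          linarith
        calc _ ≤ 2 * d * 3 ^ (d - 1) *
              ∑ r ∈ Finset.Icc 1 R, nearConst d * (1 / δ * (1 / R ^ (d - 1))) * 2 :=
              mul_le_mul_of_nonneg_left (Finset.sum_le_sum hterm) (by positivity)
          _ = _ := by
              rw [Finset.sum_const, Nat.card_Icc, nsmul_eq_mul, Nat.add_sub_cancel]
              ring

/-- At the threshold the means are `≲ R^(-κ)`, a geometric series over `R = 2^i`. The sum over all
scales is integrable, hence almost everywhere finite, and it bounds every term. -/
theorem ae_exists_badSum_le {d : ℕ} (hd : 0 < d) (κ : ℝ) (hκ : 0 < κ) :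
    ∀ᵐ h ∂symBoxMeasure d, ∃ B : ℝ, 0 ≤ B ∧ ∀ i : ℕ,
      badSum (2 ^ i) ((2 ^ i : ℝ) ^ (2 - (d : ℝ) + κ)) h ≤ ENNReal.ofReal B := by
  set c : ℝ := 4 * d * 3 ^ (d - 1) * nearConst d
  have hc : 0 ≤ c := mul_nonneg (by positivity) (nearConst_nonneg d)
  set q : ℝ := (2 : ℝ) ^ (-κ) with hq
  have hq0 : 0 ≤ q := by positivity
  have hq1 : q < 1 := Real.rpow_lt_one_of_one_lt_of_neg (by norm_num) (by linarith)
  have hint : ∫⁻ h, ∑' i : ℕ, badSum (2 ^ i) ((2 ^ i : ℝ) ^ (2 - (d : ℝ) + κ)) h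
      ∂symBoxMeasure d ≠ ⊤ := by
    rw [lintegral_tsum fun i => (measurable_badSum _ _).aemeasurable]
    refine ne_top_of_le_ne_top (b := ∑' i : ℕ, ENNReal.ofReal (c * q ^ i)) ?_
      (ENNReal.tsum_le_tsum fun i => ?_)
    · rw [← ENNReal.ofReal_tsum_of_nonneg (fun i => by positivity)
        ((summable_geometric_of_lt_one hq0 hq1).mul_left c)]
      exact ENNReal.ofReal_ne_top
    · refine (lintegral_badSum_le hd (2 ^ i) (by positivity) _ (by positivity)).trans
        (ENNReal.ofReal_le_ofReal ?_)
      refine mul_le_mul_of_nonneg_left (le_of_eq ?_) hc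
      push_cast
      set R : ℝ := 2 ^ i with hR
      have hR0 : 0 < R := by positivity
      have e1 : R ^ (d - 1) = R ^ ((d : ℝ) - 1) := by
        rw [← Real.rpow_natCast, Nat.cast_sub hd, Nat.cast_one]
      have e2 : q ^ i = R ^ (-κ) := by
        rw [hq, hR, ← Real.rpow_natCast, ← Real.rpow_natCast, ← Real.rpow_mul (by norm_num),
          ← Real.rpow_mul (by norm_num), mul_comm]
      rw [e1, e2, one_div, ← Real.rpow_neg hR0.le]
      nth_rewrite 2 [← Real.rpow_one R]
      rw [← Real.rpow_sub hR0, ← Real.rpow_add hR0]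
      congr 1
      ring
  filter_upwards [ae_lt_top (Measurable.tsum fun i => measurable_badSum _ _) hint]
    with h hh
  refine ⟨(∑' i : ℕ, badSum (2 ^ i) ((2 ^ i : ℝ) ^ (2 - (d : ℝ) + κ)) h).toReal,
    ENNReal.toReal_nonneg, fun i => ?_⟩
  rw [ENNReal.ofReal_toReal hh.ne]
  exact ENNReal.le_tsum (f := fun i : ℕ => badSum (2 ^ i) ((2 ^ i : ℝ) ^ (2 - (d : ℝ) + κ)) h) i

/-! ### Slab and bilinear counts for a controlled matrix. -/

theorem latticeTube_symApply_finite {d : ℕ} (h : Sym2 (Fin d) → ℝ) (ζ : Fin d → ℤ)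
    (hh : ∀ i j : Fin d, |symMatrix h i j - (1 : Matrix (Fin d) (Fin d) ℝ) i j| ≤
      1 / (2 * (d + 1))) (hζ : ζ ≠ 0) (S ρ : ℝ) (hS : 0 ≤ S) (hρ : 0 ≤ ρ) :
    (latticeTube (symApply h ζ) S ρ).Finite := by
  have hZ : (0 : ℝ) < latticeHeight ζ := by exact_mod_cast latticeHeight_pos hζ
  exact (latticeTube_finite_and_ncard_le _ S ρ (3 / 2 * latticeHeight ζ) hS hρ (by positivity)
    (abs_symApply_le h ζ hh)).1

/-- The number of dual vectors governing the slab of width `δ` attached to `ζ` at scale `R`. -/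
noncomputable def dualCount {d : ℕ} (h : Sym2 (Fin d) → ℝ) (R : ℕ) (δ : ℝ) (ζ : Fin d → ℤ) : ℕ :=
  (latticeTube (symApply h ζ) (1 / (6 * δ)) (1 / (12 * d * R))).ncard

/-- Duality with `S = 1/(12δ)` and `ρ = 1/(24dR)`: the two parts of the phase are at most `1/12` and
`1/24`, together below `1/6`. Doubling this tube gives the one in `dualCount`. -/
theorem card_slab_le {d : ℕ} (hd : 0 < d) (h : Sym2 (Fin d) → ℝ) (ζ : Fin d → ℤ)
    (hh : ∀ i j : Fin d, |symMatrix h i j - (1 : Matrix (Fin d) (Fin d) ℝ) i j| ≤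
      1 / (2 * (d + 1))) (hζ : ζ ≠ 0) (R : ℕ) (hR : 0 < R) (δ : ℝ) (hδ : 0 < δ) (a : ℝ)
    (X : Finset (Fin d → ℤ))
    (hX : ∀ ξ ∈ X, latticeHeight ξ ≤ R ∧ |(∑ i, (ξ i : ℝ) * symApply h ζ i) - a| ≤ δ) :
    (X.card : ℝ) ≤ 48 * (12 * d) ^ (d - 1) *
      (R ^ (d - 1) * δ * (dualCount h R δ ζ / latticeHeight ζ)) := by
  have hd0 : (0 : ℝ) < d := by exact_mod_cast hd
  have hR0 : (0 : ℝ) < R := by exact_mod_cast hR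
  have hZ : (0 : ℝ) < latticeHeight ζ := by exact_mod_cast latticeHeight_pos hζ
  obtain ⟨k, hk⟩ := exists_le_abs_symApply h ζ hζ hh
  have e1 : 2 * (1 / (12 * δ)) = 1 / (6 * δ) := by field_simp; norm_num
  have e2 : 2 * (1 / (24 * d * R) : ℝ) = 1 / (12 * d * R) := by field_simp; norm_num
  have main := card_mul_le_ncard_latticeTube (symApply h ζ) a (1 / (12 * δ)) (1 / (24 * d * R))
    (latticeHeight ζ / 2) (by positivity) (by positivity) (by positivity) k hk X ?_ ?_
  · rw [e1, e2] at main
    obtain ⟨e, rfl⟩ : ∃ e, d = e + 1 := ⟨d - 1, by omega⟩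
    rw [Nat.add_sub_cancel]
    change _ ≤ 4 * _ * (dualCount h R δ ζ : ℝ) at main
    set M : ℝ := (dualCount h R δ ζ : ℝ)
    set Z : ℝ := (latticeHeight ζ : ℝ)
    set D : ℝ := ((e + 1 : ℕ) : ℝ)
    rw [div_pow, one_pow, pow_succ] at main
    have h3 : (X.card : ℝ) * Z ≤ 48 * (12 * D * R) ^ e * δ * M := by
      have h4 : (X.card : ℝ) * (1 / (12 * δ) * (1 / ((12 * D * R) ^ e * (12 * D * R))) * (Z / 2))
          = (X.card * Z) * (1 / (288 * δ * D * R * (12 * D * R) ^ e)) := by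
        field_simp; ring
      rw [h4, mul_one_div, div_le_iff₀ (by positivity)] at main
      refine main.trans (le_of_eq ?_)
      field_simp
      ring
    have h5 : 48 * (12 * D) ^ e * (R ^ e * δ * (M / Z)) = (48 * (12 * D * R) ^ e * δ * M) / Z := by
      rw [mul_pow (12 * D)]
      field_simp
    rw [h5, le_div_iff₀ hZ]
    exact h3
  · intro ξ hξ s y hs hy
    obtain ⟨h1, h2⟩ := hX ξ hξ
    have h3 : |∑ i, (ξ i : ℝ) * y i| ≤ 1 / 24 := by
      calc _ ≤ ∑ i, |(ξ i : ℝ) * y i| := Finset.abs_sum_le_sum_abs _ _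
        _ ≤ ∑ _i : Fin d, (R : ℝ) * (1 / (24 * d * R)) := by
            refine Finset.sum_le_sum fun i _ => ?_
            rw [abs_mul]
            refine mul_le_mul ((abs_le_latticeHeight ξ i).trans ?_) (hy i) (abs_nonneg _)
              (by positivity)
            exact_mod_cast h1
        _ = 1 / 24 := by
            rw [Finset.sum_const, Finset.card_univ, Fintype.card_fin, nsmul_eq_mul]
            field_simp
    have h4 : |s * ((∑ i, (ξ i : ℝ) * symApply h ζ i) - a)| ≤ 1 / 12 := by
      rw [abs_mul]
      calc _ ≤ 1 / (12 * δ) * δ := mul_le_mul hs h2 (abs_nonneg _) (by positivity)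
        _ = 1 / 12 := by field_simp
    exact (abs_add_le _ _).trans (by linarith)
  · exact latticeTube_symApply_finite h ζ hh hζ _ _ (by positivity) (by positivity)

theorem scale_le {d R : ℕ} (hd : 3 ≤ d) (hR : 0 < R) :
    (1 / (12 * d * R) : ℝ) ≤ 1 / 36 := by
  have hd3 : (3 : ℝ) ≤ d := by exact_mod_cast hd
  have hR1 : (1 : ℝ) ≤ R := by exact_mod_cast hR
  gcongr
  nlinarith

/-- The origin contributes `∑ 1/|ζ| ≲ R^(d-1)`, and the nonzero dual vectors are bounded on average
by the first part of `badSum`. -/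
theorem sum_dualCount_le {d : ℕ} (hd : 3 ≤ d) (h : Sym2 (Fin d) → ℝ)
    (hh : ∀ i j : Fin d, |symMatrix h i j - (1 : Matrix (Fin d) (Fin d) ℝ) i j| ≤
      1 / (2 * (d + 1))) (R : ℕ) (hR : 0 < R) (δ : ℝ) (hδ : 0 < δ) (B : ℝ) (hB : 0 ≤ B)
    (hbad : badSum R δ h ≤ ENNReal.ofReal B) :
    ∑ ζ ∈ (latticeBox d R).filter (· ≠ 0), (dualCount h R δ ζ : ℝ) / latticeHeight ζ ≤
      (2 * d * 3 ^ (d - 1) + B) * R ^ (d - 1) := by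
  have hR0 : (0 : ℝ) < R := by exact_mod_cast hR
  set F := (latticeBox d R).filter (· ≠ 0)
  have h1 : ∑ ζ ∈ F, 1 / (latticeHeight ζ : ℝ) ≤ 2 * d * 3 ^ (d - 1) * R ^ (d - 1) := by
    refine (sum_latticeBox_le d R (fun r => 1 / (r : ℝ)) fun r => by positivity).trans ?_
    gcongr
    obtain ⟨e, rfl⟩ : ∃ e, d = e + 2 := ⟨d - 2, by omega⟩
    calc _ ≤ ∑ r ∈ Finset.Icc 1 R, (R : ℝ) ^ e := by
          refine Finset.sum_le_sum fun r hr => ?_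
          obtain ⟨hr1, hr2⟩ := Finset.mem_Icc.1 hr
          have hr0 : (0 : ℝ) < r := by exact_mod_cast hr1
          have : (r : ℝ) ^ (e + 2 - 1) * (1 / r) = r ^ e := by
            rw [show e + 2 - 1 = e + 1 by omega, pow_succ]; field_simp
          rw [this]
          gcongr
      _ = _ := by
          rw [Finset.sum_const, Nat.card_Icc, nsmul_eq_mul, Nat.add_sub_cancel,
            show e + 2 - 1 = e + 1 by omega, pow_succ']
  have h2 : ENNReal.ofReal (∑ ζ ∈ F, 1 / (latticeHeight ζ * R ^ (d - 1) : ℝ) * dualCount h R δ ζ) ≤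
      ENNReal.ofReal ((∑ ζ ∈ F, 1 / (latticeHeight ζ * R ^ (d - 1) : ℝ)) + B) := by
    rw [ENNReal.ofReal_sum_of_nonneg fun ζ _ => by positivity,
      ENNReal.ofReal_add (Finset.sum_nonneg fun ζ _ => by positivity) hB,
      ENNReal.ofReal_sum_of_nonneg fun ζ _ => by positivity]
    refine le_trans ?_ (add_le_add_right hbad _)
    unfold badSum
    rw [← Finset.sum_add_distrib]
    refine Finset.sum_le_sum fun ζ hζ => ?_
    have hζ0 := (Finset.mem_filter.1 hζ).2
    have hZ : (0 : ℝ) < latticeHeight ζ := by exact_mod_cast latticeHeight_pos hζ0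
    have h3 : (dualCount h R δ ζ : ENNReal) ≤
        1 + nearCount ζ ⌊latticeHeight ζ / δ⌋₊ (1 / (12 * d * R)) h := by
      refine ncard_latticeTube_le_nearCount h ζ hh hζ0 _ _ (by positivity)
        ((scale_le hd hR).trans (by norm_num)) _ ?_
      refine lt_of_le_of_lt ?_ (Nat.lt_floor_add_one _)
      have : 2 * (1 / (6 * δ)) * (latticeHeight ζ : ℝ) = 1 / 3 * (latticeHeight ζ / δ) := by
        field_simp; norm_num
      rw [this]
      have : 0 ≤ (latticeHeight ζ : ℝ) / δ := by positivity
      linarith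
    rw [ENNReal.ofReal_mul (by positivity), ENNReal.ofReal_natCast, ← add_assoc]
    refine le_trans (mul_le_mul_right h3 _) ?_
    rw [mul_add, mul_one]
    exact le_self_add
  have h4 := (ENNReal.ofReal_le_ofReal_iff (add_nonneg
    (Finset.sum_nonneg fun ζ _ => by positivity) hB)).1 h2
  have hp : (0 : ℝ) < R ^ (d - 1) := by positivity
  have h5 : ∑ ζ ∈ F, 1 / (latticeHeight ζ * R ^ (d - 1) : ℝ) * dualCount h R δ ζ
      = (∑ ζ ∈ F, (dualCount h R δ ζ : ℝ) / latticeHeight ζ) / R ^ (d - 1) := by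
    rw [Finset.sum_div]
    refine Finset.sum_congr rfl fun ζ _ => ?_
    rw [div_div, one_div_mul_eq_div]
  have h6 : ∑ ζ ∈ F, 1 / (latticeHeight ζ * R ^ (d - 1) : ℝ)
      = (∑ ζ ∈ F, 1 / (latticeHeight ζ : ℝ)) / R ^ (d - 1) := by
    rw [Finset.sum_div]
    refine Finset.sum_congr rfl fun ζ _ => ?_
    rw [div_div]
  rw [h5, h6, div_le_iff₀ hp, add_mul, div_mul_cancel₀ _ hp.ne'] at h4
  linarith

/-- Log-convexity with dilation factor `m = |ζ|`: the shrunk tube has at most `1 + B` points by the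
second part of `badSum`, the enlarged one `≲ |ζ|²/δ` trivially. The bound is the geometric mean. -/
theorem dualCount_le {d : ℕ} (hd : 3 ≤ d) (h : Sym2 (Fin d) → ℝ) (ζ : Fin d → ℤ)
    (hh : ∀ i j : Fin d, |symMatrix h i j - (1 : Matrix (Fin d) (Fin d) ℝ) i j| ≤
      1 / (2 * (d + 1))) (hζ : ζ ≠ 0) (R : ℕ) (hR : 0 < R) (hζR : latticeHeight ζ ≤ R)
    (δ : ℝ) (hδ : 0 < δ) (hδ1 : δ ≤ 1) (B : ℝ) (hB : 0 ≤ B)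
    (hbad : badSum R δ h ≤ ENNReal.ofReal B) :
    (dualCount h R δ ζ : ℝ) ≤ Real.sqrt ((1 + B) * (6 * 5 ^ d)) * (latticeHeight ζ / Real.sqrt δ) := by
  have hd0 : 0 < d := by omega
  have hd3 : (3 : ℝ) ≤ d := by exact_mod_cast hd
  have hR1 : (1 : ℝ) ≤ R := by exact_mod_cast hR
  have hZn := latticeHeight_pos hζ
  have hZ : (1 : ℝ) ≤ latticeHeight ζ := by exact_mod_cast hZn
  have hZR : (latticeHeight ζ : ℝ) ≤ R := by exact_mod_cast hζR
  set Z : ℝ := (latticeHeight ζ : ℝ) with hZdef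
  have hfin := fun S ρ => latticeTube_symApply_finite h ζ hh hζ S ρ
  have hsq := ncard_latticeTube_sq_le (symApply h ζ) (1 / (6 * δ)) (1 / (12 * d * R))
    (latticeHeight ζ) hZn (hfin _ _ (by positivity) (by positivity))
    (hfin _ _ (by positivity) (by positivity)) (hfin _ _ (by positivity) (by positivity))
  have h1 : ((latticeTube (symApply h ζ) (2 * (1 / (6 * δ)) / Z)
      (2 * (1 / (12 * d * R)) / Z)).ncard : ℝ) ≤ 1 + B := by
    have e : 2 * (1 / (12 * d * R)) / Z = 1 / (6 * d * R * Z) := by field_simp; norm_num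
    have h2 : ((latticeTube (symApply h ζ) (2 * (1 / (6 * δ)) / Z)
        (2 * (1 / (12 * d * R)) / Z)).ncard : ENNReal) ≤
        1 + nearCount ζ ⌊1 / δ⌋₊ (1 / (6 * d * R * Z)) h := by
      rw [e]
      refine ncard_latticeTube_le_nearCount h ζ hh hζ _ _ (by positivity) ?_ _ ?_
      · rw [← e]
        refine (div_le_self (by positivity) hZ).trans ?_
        linarith [scale_le hd hR]
      · refine lt_of_le_of_lt ?_ (Nat.lt_floor_add_one _)
        have : 2 * (2 * (1 / (6 * δ)) / Z) * Z = 2 / 3 * (1 / δ) := by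
          field_simp; norm_num
        rw [← hZdef, this]
        have : 0 ≤ 1 / δ := by positivity
        linarith
    have h3 : nearCount ζ ⌊1 / δ⌋₊ (1 / (6 * d * R * Z)) h ≤ ENNReal.ofReal B := by
      refine le_trans ?_ hbad
      unfold badSum
      refine le_trans le_add_self (Finset.single_le_sum (f := fun ζ : Fin d → ℤ =>
        (ENNReal.ofReal (1 / (latticeHeight ζ * R ^ (d - 1))) *
          nearCount ζ ⌊latticeHeight ζ / δ⌋₊ (1 / (12 * d * R)) h +
        nearCount ζ ⌊1 / δ⌋₊ (1 / (6 * d * R * latticeHeight ζ)) h)) (fun _ _ => zero_le)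
        (Finset.mem_filter.2 ⟨mem_latticeBox.2 hζR, hζ⟩))
    have h4 := h2.trans (add_le_add_right h3 1)
    rw [← ENNReal.ofReal_one, ← ENNReal.ofReal_add zero_le_one hB, ← ENNReal.ofReal_natCast,
      ENNReal.ofReal_le_ofReal_iff (by positivity)] at h4
    exact h4
  have h2 : ((latticeTube (symApply h ζ) ((Z + 1) * (1 / (6 * δ)))
      ((Z + 1) * (1 / (12 * d * R)))).ncard : ℝ) ≤ 6 * 5 ^ d * (Z ^ 2 / δ) := by
    refine (latticeTube_finite_and_ncard_le _ _ _ (3 / 2 * Z) (by positivity) (by positivity)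
      (by positivity) (abs_symApply_le h ζ hh)).2.trans ?_
    -- Since `|ζ| ≤ R`, the enlarged tube still has radius at most `1`, so its count is governed by
    -- its length.
    have hρ : (Z + 1) * (1 / (12 * d * R)) ≤ 1 := by
      rw [mul_one_div, div_le_one (by positivity)]
      nlinarith
    have hδ2 : 1 ≤ 1 / δ := by rw [le_div_iff₀ hδ]; linarith
    have hS : 2 * ((Z + 1) * (1 / (6 * δ))) * (3 / 2 * Z) + 3 ≤ 6 * (Z ^ 2 / δ) := by
      have e : 2 * ((Z + 1) * (1 / (6 * δ))) * (3 / 2 * Z) = (Z ^ 2 + Z) / 2 * (1 / δ) := by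
        field_simp; norm_num
      have h3 : 1 ≤ Z * (1 / δ) := one_le_mul_of_one_le_of_one_le hZ hδ2
      have h4 : Z * (1 / δ) ≤ Z ^ 2 * (1 / δ) := by gcongr; nlinarith
      rw [e, div_eq_mul_one_div (Z ^ 2)]
      linarith
    calc _ ≤ 6 * (Z ^ 2 / δ) * (2 * 1 + 3) ^ d := by gcongr
      _ = _ := by norm_num; ring
  have h3 : (dualCount h R δ ζ : ℝ) ^ 2 ≤ (1 + B) * (6 * 5 ^ d) * (Z / Real.sqrt δ) ^ 2 := by
    have hsq' := (Nat.cast_le (α := ℝ)).2 hsq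
    rw [Nat.cast_pow, Nat.cast_mul] at hsq'
    calc (dualCount h R δ ζ : ℝ) ^ 2 ≤ _ := hsq'
      _ ≤ (1 + B) * (6 * 5 ^ d * (Z ^ 2 / δ)) :=
          mul_le_mul h1 h2 (Nat.cast_nonneg _) (by positivity)
      _ = _ := by rw [div_pow, Real.sq_sqrt hδ.le]; ring
  have h4 := Real.sqrt_le_sqrt h3
  rwa [Real.sqrt_sq (Nat.cast_nonneg _), Real.sqrt_mul (by positivity),
    Real.sqrt_sq (by positivity)] at h4

theorem card_slab_le_sqrt {d : ℕ} (hd : 3 ≤ d) (h : Sym2 (Fin d) → ℝ) (ζ : Fin d → ℤ)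
    (hh : ∀ i j : Fin d, |symMatrix h i j - (1 : Matrix (Fin d) (Fin d) ℝ) i j| ≤
      1 / (2 * (d + 1))) (hζ : ζ ≠ 0) (R : ℕ) (hR : 0 < R) (hζR : latticeHeight ζ ≤ R)
    (δ : ℝ) (hδ : 0 < δ) (hδ1 : δ ≤ 1) (B : ℝ) (hB : 0 ≤ B)
    (hbad : badSum R δ h ≤ ENNReal.ofReal B) (a : ℝ) (X : Finset (Fin d → ℤ))
    (hX : ∀ ξ ∈ X, latticeHeight ξ ≤ R ∧ |(∑ i, (ξ i : ℝ) * symApply h ζ i) - a| ≤ δ) :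
    (X.card : ℝ) ≤ 48 * (12 * d) ^ (d - 1) * Real.sqrt ((1 + B) * (6 * 5 ^ d)) *
      (R ^ (d - 1) * Real.sqrt δ) := by
  have hZ : (0 : ℝ) < latticeHeight ζ := by exact_mod_cast latticeHeight_pos hζ
  have hs : 0 < Real.sqrt δ := Real.sqrt_pos.2 hδ
  refine (card_slab_le (by omega) h ζ hh hζ R hR δ hδ a X hX).trans ?_
  have h1 := dualCount_le hd h ζ hh hζ R hR hζR δ hδ hδ1 B hB hbad
  calc _ ≤ 48 * (12 * d) ^ (d - 1) * (R ^ (d - 1) * δ *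
        (Real.sqrt ((1 + B) * (6 * 5 ^ d)) * (latticeHeight ζ / Real.sqrt δ) / latticeHeight ζ)) := by
        gcongr
    _ = 48 * (12 * d) ^ (d - 1) * (R ^ (d - 1) * (Real.sqrt δ * Real.sqrt δ) *
        (Real.sqrt ((1 + B) * (6 * 5 ^ d)) * (latticeHeight ζ / Real.sqrt δ) / latticeHeight ζ)) := by
        rw [Real.mul_self_sqrt hδ.le]
    _ = _ := by field_simp

/-- Sum the slab bound over the first vector `ζ`. For `ζ = 0` the form may give no restriction, and
`hRδ` is what lets its `≲ R^d` pairs be absorbed. -/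
theorem card_pairs_le {d : ℕ} (hd : 3 ≤ d) (h : Sym2 (Fin d) → ℝ)
    (hh : ∀ i j : Fin d, |symMatrix h i j - (1 : Matrix (Fin d) (Fin d) ℝ) i j| ≤
      1 / (2 * (d + 1))) (R : ℕ) (hR : 0 < R) (δ : ℝ) (hδ : 0 < δ) (B : ℝ) (hB : 0 ≤ B)
    (hbad : badSum R δ h ≤ ENNReal.ofReal B)
    (hRδ : (R : ℝ) ^ d ≤ (R ^ (d - 1) : ℝ) ^ 2 * δ) (a : ℝ)
    (P : Finset ((Fin d → ℤ) × (Fin d → ℤ)))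
    (hP : ∀ p ∈ P, latticeHeight p.1 ≤ R ∧ latticeHeight p.2 ≤ R ∧
      |(∑ i, (p.2 i : ℝ) * symApply h p.1 i) - a| ≤ δ) :
    (P.card : ℝ) ≤ (3 ^ d + 48 * (12 * d) ^ (d - 1) * (2 * d * 3 ^ (d - 1) + B)) *
      ((R ^ (d - 1) : ℝ) ^ 2 * δ) := by
  classical
  have hR1 : (1 : ℝ) ≤ R := by exact_mod_cast hR
  have hmaps : ∀ p ∈ P, p.1 ∈ latticeBox d R := fun p hp => mem_latticeBox.2 (hP p hp).1
  let X : (Fin d → ℤ) → Finset (Fin d → ℤ) := fun ζ => (P.filter fun p => p.1 = ζ).image Prod.snd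
  have hXcard : ∀ ζ, (P.filter fun p => p.1 = ζ).card = (X ζ).card := by
    intro ζ
    refine (Finset.card_image_of_injOn fun p hp q hq hpq => ?_).symm
    have h1 := (Finset.mem_filter.1 (Finset.mem_coe.1 hp)).2
    have h2 := (Finset.mem_filter.1 (Finset.mem_coe.1 hq)).2
    exact Prod.ext (h1.trans h2.symm) hpq
  have hX : ∀ ζ, ∀ ξ ∈ X ζ, latticeHeight ξ ≤ R ∧
      |(∑ i, (ξ i : ℝ) * symApply h ζ i) - a| ≤ δ := by
    intro ζ ξ hξ
    obtain ⟨p, hp, rfl⟩ := Finset.mem_image.1 hξ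
    obtain ⟨hpP, rfl⟩ := Finset.mem_filter.1 hp
    exact (hP p hpP).2
  have h0 : ((X 0).card : ℝ) ≤ 3 ^ d * R ^ d := by
    calc ((X 0).card : ℝ) ≤ ((latticeBox d R).card : ℝ) := by
          exact_mod_cast Finset.card_le_card fun ξ hξ => mem_latticeBox.2 (hX 0 ξ hξ).1
      _ = (2 * R + 1) ^ d := by rw [card_latticeBox]; push_cast; ring
      _ ≤ (3 * R) ^ d := by gcongr; linarith
      _ = _ := mul_pow _ _ _
  have h0mem : (0 : Fin d → ℤ) ∈ latticeBox d R := by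
    rw [mem_latticeBox, latticeHeight_le_iff]; simp
  rw [Finset.card_eq_sum_card_fiberwise hmaps]
  simp only [hXcard]
  rw [← Finset.add_sum_erase _ _ h0mem, ← Finset.filter_ne']
  push_cast
  calc _ ≤ 3 ^ d * (R : ℝ) ^ d + ∑ ζ ∈ (latticeBox d R).filter (· ≠ 0),
        48 * (12 * d) ^ (d - 1) *
          (R ^ (d - 1) * δ * ((dualCount h R δ ζ : ℝ) / latticeHeight ζ)) := by
        refine add_le_add h0 (Finset.sum_le_sum fun ζ hζ => ?_)
        exact card_slab_le (by omega) h ζ hh (Finset.mem_filter.1 hζ).2 R hR δ hδ a _ (hX ζ)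
    _ ≤ 3 ^ d * ((R ^ (d - 1) : ℝ) ^ 2 * δ) + 48 * (12 * d) ^ (d - 1) *
          (R ^ (d - 1) * δ * ((2 * d * 3 ^ (d - 1) + B) * R ^ (d - 1))) := by
        rw [← Finset.mul_sum, ← Finset.mul_sum]
        gcongr
        exact sum_dualCount_le hd h hh R hR δ hδ B hB hbad
    _ = _ := by ring

/-! ### From the bilinear form to the quadratic form. -/

theorem latticeForm_symMatrix {d : ℕ} (h : Sym2 (Fin d) → ℝ) (ζ ξ : Fin d → ℤ) :
    latticeForm (symMatrix h) ζ ξ = ∑ i, (ξ i : ℝ) * symApply h ζ i := by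
  simp only [latticeForm, dotProduct, Matrix.mulVec, symMatrix, latticeVec, Matrix.of_apply,
    symApply]
  exact Finset.sum_congr rfl fun i _ => mul_comm _ _

theorem latticeForm_symMatrix_comm {d : ℕ} (h : Sym2 (Fin d) → ℝ) (ζ ξ : Fin d → ℤ) :
    latticeForm (symMatrix h) ζ ξ = latticeForm (symMatrix h) ξ ζ := by
  rw [latticeForm_symMatrix, latticeForm_symMatrix]
  simp only [symApply, Finset.mul_sum]
  rw [Finset.sum_comm]
  refine Finset.sum_congr rfl fun i _ => Finset.sum_congr rfl fun j _ => ?_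
  rw [Sym2.eq_swap]
  ring

theorem latticeForm_sub_add {d : ℕ} (h : Sym2 (Fin d) → ℝ) (η ξ : Fin d → ℤ) :
    latticeForm (symMatrix h) (η - ξ) (η + ξ)
      = latticeQuad (symMatrix h) η - latticeQuad (symMatrix h) ξ := by
  have hsub : ∀ x y : Fin d → ℤ, latticeVec (x - y) = latticeVec x - latticeVec y := by
    intro x y; funext i; simp [latticeVec]
  have hadd : ∀ x y : Fin d → ℤ, latticeVec (x + y) = latticeVec x + latticeVec y := by
    intro x y; funext i; simp [latticeVec]
  have hc := latticeForm_symMatrix_comm h η ξ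
  simp only [latticeQuad, latticeForm, hsub, hadd, Matrix.mulVec_sub, sub_dotProduct,
    dotProduct_add] at hc ⊢
  linarith

/-- Two points of `A` have quadratic values within `2δ` of each other, so `(η - ξ, η + ξ)` is a pair
with small bilinear form. This embeds `A × A` into a set of `≲ R^(2d-2) δ` pairs; then take a square
root. -/
theorem card_quad_le {d : ℕ} (hd : 3 ≤ d) (h : Sym2 (Fin d) → ℝ)
    (hh : ∀ i j : Fin d, |symMatrix h i j - (1 : Matrix (Fin d) (Fin d) ℝ) i j| ≤
      1 / (2 * (d + 1))) (R : ℕ) (hR : 0 < R) (δ : ℝ) (hδ : 0 < δ) (B : ℝ) (hB : 0 ≤ B)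
    (hbad : badSum R δ h ≤ ENNReal.ofReal B)
    (hRδ : (R : ℝ) ^ d ≤ (R ^ (d - 1) : ℝ) ^ 2 * δ) (a : ℝ) (A : Finset (Fin d → ℤ))
    (hA : ∀ η ∈ A, (∀ i, 2 * |(η i : ℝ)| ≤ R) ∧ |latticeQuad (symMatrix h) η - a| ≤ δ) :
    (A.card : ℝ) ≤
      Real.sqrt (2 * (3 ^ d + 48 * (12 * d) ^ (d - 1) * (2 * d * 3 ^ (d - 1) + B))) *
      (R ^ (d - 1) * Real.sqrt δ) := by
  classical
  set c : ℝ := 3 ^ d + 48 * (12 * d) ^ (d - 1) * (2 * d * 3 ^ (d - 1) + B)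
  have hc : 0 ≤ c := by positivity
  let P : Finset ((Fin d → ℤ) × (Fin d → ℤ)) :=
    (A ×ˢ A).image fun p => (p.1 - p.2, p.1 + p.2)
  have hPcard : P.card = A.card ^ 2 := by
    rw [Finset.card_image_of_injective, Finset.card_product, sq]
    intro p q hpq
    have h1 : p.1 - p.2 = q.1 - q.2 := congrArg Prod.fst hpq
    have h2 : p.1 + p.2 = q.1 + q.2 := congrArg Prod.snd hpq
    refine Prod.ext (funext fun i => ?_) (funext fun i => ?_)
    · have h3 := congrFun h1 i
      have h4 := congrFun h2 i
      simp only [Pi.sub_apply, Pi.add_apply] at h3 h4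
      omega
    · have h3 := congrFun h1 i
      have h4 := congrFun h2 i
      simp only [Pi.sub_apply, Pi.add_apply] at h3 h4
      omega
  have hPprop : ∀ p ∈ P, latticeHeight p.1 ≤ R ∧ latticeHeight p.2 ≤ R ∧
      |∑ i, (p.2 i : ℝ) * symApply h p.1 i| ≤ 2 * δ := by
    intro p hp
    obtain ⟨⟨x, y⟩, hq, rfl⟩ := Finset.mem_image.1 hp
    obtain ⟨hx, hy⟩ := Finset.mem_product.1 hq
    obtain ⟨hx1, hx2⟩ := hA x hx
    obtain ⟨hy1, hy2⟩ := hA y hy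
    have hz1 : ∀ i, 2 * |x i| ≤ (R : ℤ) := fun i => by exact_mod_cast hx1 i
    have hz2 : ∀ i, 2 * |y i| ≤ (R : ℤ) := fun i => by exact_mod_cast hy1 i
    refine ⟨latticeHeight_le_iff.2 fun i => ?_, latticeHeight_le_iff.2 fun i => ?_, ?_⟩
    · refine (abs_sub _ _).trans ?_
      linarith [hz1 i, hz2 i]
    · refine (abs_add_le _ _).trans ?_
      linarith [hz1 i, hz2 i]
    · rw [← latticeForm_symMatrix, latticeForm_sub_add]
      rw [abs_le] at *
      constructor <;> linarith
  -- The window `|f| ≤ 2δ` is covered by the windows of half-width `δ` about `δ` and `-δ`, so the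
  -- pair bound applies with the same `δ`.
  let f : (Fin d → ℤ) × (Fin d → ℤ) → ℝ := fun p => ∑ i, (p.2 i : ℝ) * symApply h p.1 i
  have h1 := card_pairs_le hd h hh R hR δ hδ B hB hbad hRδ δ (P.filter fun p => 0 ≤ f p) (by
    intro p hp
    obtain ⟨hp, hf⟩ := Finset.mem_filter.1 hp
    obtain ⟨h1, h2, h3⟩ := hPprop p hp
    refine ⟨h1, h2, ?_⟩
    change |f p - δ| ≤ δ
    change |f p| ≤ 2 * δ at h3
    rw [abs_le] at *
    constructor <;> linarith)
  have h2 := card_pairs_le hd h hh R hR δ hδ B hB hbad hRδ (-δ) (P.filter fun p => ¬ 0 ≤ f p) (by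
    intro p hp
    obtain ⟨hp, hf⟩ := Finset.mem_filter.1 hp
    obtain ⟨h1, h2, h3⟩ := hPprop p hp
    refine ⟨h1, h2, ?_⟩
    change |f p - -δ| ≤ δ
    change |f p| ≤ 2 * δ at h3
    rw [abs_le] at *
    constructor <;> linarith)
  have h3 : ((A.card : ℝ)) ^ 2 ≤ 2 * c * (R ^ (d - 1) * Real.sqrt δ) ^ 2 := by
    have e : (P.card : ℝ) = ((P.filter fun p => 0 ≤ f p).card : ℝ)
        + ((P.filter fun p => ¬ 0 ≤ f p).card : ℝ) := by
      exact_mod_cast (Finset.card_filter_add_card_filter_not (s := P) fun p => 0 ≤ f p).symm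
    rw [hPcard] at e
    push_cast at e
    rw [e, mul_pow, Real.sq_sqrt hδ.le]
    linarith
  have h4 := Real.sqrt_le_sqrt h3
  rwa [Real.sqrt_sq (Nat.cast_nonneg _), Real.sqrt_mul (by positivity),
    Real.sqrt_sq (by positivity)] at h4

/-! ### Euclidean norms, dyadic scales and the conclusion. -/

theorem countLe_of_forall_finset {α : Type*} (S : Set α) (F : Finset α) (hS : S ⊆ F) (B : ℝ)
    (hB : ∀ X : Finset α, (∀ x ∈ X, x ∈ S) → (X.card : ℝ) ≤ B) : CountLe S B := by
  have hfin : S.Finite := F.finite_toSet.subset hS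
  refine ⟨hfin, ?_⟩
  rw [Set.ncard_eq_toFinset_card _ hfin]
  exact hB _ fun x hx => hfin.mem_toFinset.1 hx

theorem abs_le_latticeNorm {d : ℕ} (ξ : Fin d → ℤ) (i : Fin d) : |(ξ i : ℝ)| ≤ latticeNorm ξ := by
  have := PiLp.norm_apply_le (WithLp.toLp 2 (latticeVec ξ) : EuclideanSpace ℝ (Fin d)) i
  simpa [latticeVec, latticeNorm] using this

theorem latticeHeight_le_of_latticeNorm_le {d : ℕ} (ξ : Fin d → ℤ) (R : ℕ)
    (h : latticeNorm ξ ≤ R) : latticeHeight ξ ≤ R :=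
  latticeHeight_le_iff.2 fun i => by exact_mod_cast (abs_le_latticeNorm ξ i).trans h

theorem ne_zero_of_one_le_latticeNorm {d : ℕ} {ζ : Fin d → ℤ} (h : 1 ≤ latticeNorm ζ) :
    ζ ≠ 0 := by
  rintro rfl
  have : latticeVec (0 : Fin d → ℤ) = 0 := by funext i; simp [latticeVec]
  rw [latticeNorm, this, WithLp.toLp_zero, norm_zero] at h
  linarith

theorem mem_symBox {d : ℕ} (h : Sym2 (Fin d) → ℝ)
    (hh : ∀ i j : Fin d, |symMatrix h i j - (1 : Matrix (Fin d) (Fin d) ℝ) i j| ≤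
      1 / (2 * (d + 1))) : h ∈ Set.univ.pi fun _ : Sym2 (Fin d) => Set.Icc (-1 : ℝ) 2 := by
  intro p _
  induction p using Sym2.ind with
  | _ i j =>
    have h1 := hh i j
    have h2 : (1 / (2 * (d + 1)) : ℝ) ≤ 1 := by
      rw [div_le_one (by positivity)]
      linarith [Nat.cast_nonneg (α := ℝ) d]
    have h3 : symMatrix h i j = h s(i, j) := rfl
    rw [h3, Matrix.one_apply] at h1
    rw [abs_le] at h1
    split_ifs at h1 <;> constructor <;> linarith

theorem ae_volume_of_ae_symBoxMeasure {d : ℕ} {p : (Sym2 (Fin d) → ℝ) → Prop}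
    (hp : ∀ᵐ h ∂symBoxMeasure d, p h) :
    ∀ᵐ h ∂(volume : Measure (Sym2 (Fin d) → ℝ)),
      (∀ i j : Fin d, |symMatrix h i j - (1 : Matrix (Fin d) (Fin d) ℝ) i j| ≤
        1 / (2 * (d + 1))) → p h := by
  rw [symBoxMeasure, ← Measure.restrict_pi_pi, ← volume_pi,
    ae_restrict_iff' (MeasurableSet.univ_pi fun _ => measurableSet_Icc)] at hp
  filter_upwards [hp] with h h1 h2
  exact h1 (mem_symBox h h2)

/-- The three counting estimates for a fixed matrix whose dual vectors are under control. -/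
theorem countLe_of_badSum_le {d : ℕ} (hd : 3 ≤ d) (h : Sym2 (Fin d) → ℝ)
    (hh : ∀ i j : Fin d, |symMatrix h i j - (1 : Matrix (Fin d) (Fin d) ℝ) i j| ≤
      1 / (2 * (d + 1))) (κ : ℝ) (hκ : 0 < κ) (hκ1 : κ ≤ 1) (B : ℝ) (hB : 0 ≤ B)
    (hbad : ∀ i : ℕ, badSum (2 ^ i) ((2 ^ i : ℝ) ^ (2 - (d : ℝ) + κ)) h ≤ ENNReal.ofReal B) :
    ∃ C : ℝ, 0 < C ∧
      ∀ L δ : ℝ, 1 ≤ L → L ^ (2 - (d : ℝ) + κ) < δ → δ < 1 →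
        (∀ ζ : Fin d → ℤ, 1 ≤ latticeNorm ζ → latticeNorm ζ ≤ L →
          CountLe {ξ : Fin d → ℤ |
              latticeNorm ξ ≤ L ∧ |latticeForm (symMatrix h) ζ ξ| < δ}
            (C * (L ^ ((d : ℝ) - 1) * Real.sqrt δ))) ∧
        (∀ a : ℝ,
          CountLe {η : Fin d → ℤ |
              latticeNorm η < L ∧ |latticeQuad (symMatrix h) η - a| < δ}
            (C * (L ^ ((d : ℝ) - 1) * Real.sqrt δ))) ∧
        (∀ a : ℝ,
          CountLe {p : (Fin d → ℤ) × (Fin d → ℤ) |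
              latticeNorm p.1 ≤ L ∧ latticeNorm p.2 ≤ L ∧
                |latticeForm (symMatrix h) p.1 p.2 - a| ≤ δ}
            (C * (L ^ (2 * (d : ℝ) - 2) * δ))) := by
  have hd3 : (3 : ℝ) ≤ d := by exact_mod_cast hd
  set c₁ : ℝ := 48 * (12 * d) ^ (d - 1) * Real.sqrt ((1 + B) * (6 * 5 ^ d))
  set c₃ : ℝ := 3 ^ d + 48 * (12 * d) ^ (d - 1) * (2 * d * 3 ^ (d - 1) + B)
  have hc₁ : 0 ≤ c₁ := by positivity
  have hc₃ : 0 ≤ c₃ := by positivity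
  set q : ℝ := 4 ^ (d - 1)
  have hq : 0 < q := by positivity
  refine ⟨c₁ * q + Real.sqrt (2 * c₃) * q + c₃ * q ^ 2 + 1, by positivity, ?_⟩
  intro L δ hL hδ hδ1
  have hL0 : 0 < L := by linarith
  have hδ0 : 0 < δ := lt_trans (by positivity) hδ
  -- `R` is a power of two with `2L ≤ R ≤ 4L`. The factor `2` leaves room for sums and differences
  -- of vectors of length at most `L`; the factor `4` costs the constant `q`.
  obtain ⟨n, hn1, hn2⟩ := exists_nat_pow_near (x := 2 * L) (y := 2) (by linarith) one_lt_two
  set R : ℕ := 2 ^ (n + 1) with hRdef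
  have hR : 0 < R := by positivity
  have hRr : (R : ℝ) = 2 ^ (n + 1) := by simp [hRdef]
  have hR0 : (0 : ℝ) < R := by exact_mod_cast hR
  have hR1 : (1 : ℝ) ≤ R := by exact_mod_cast hR
  have hLR : 2 * L ≤ R := by rw [hRr]; exact hn2.le
  have hLR1 : L ≤ R := by linarith
  have hRL : (R : ℝ) ≤ 4 * L := by rw [hRr, pow_succ]; linarith
  -- The exponent is nonpositive because `d ≥ 3` and `κ ≤ 1`, so passing from `L` to the larger `R`
  -- lowers the threshold.
  have hRδ : (R : ℝ) ^ (2 - (d : ℝ) + κ) ≤ δ :=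
    (Real.rpow_le_rpow_of_nonpos hL0 hLR1 (by linarith)).trans hδ.le
  have hbadR : badSum R δ h ≤ ENNReal.ofReal B := by
    refine (badSum_anti R (by positivity) hRδ h).trans ?_
    rw [hRr]
    exact hbad (n + 1)
  have hpow : ((R : ℝ) ^ (d - 1)) = (R : ℝ) ^ ((d : ℝ) - 1) := by
    rw [← Real.rpow_natCast, Nat.cast_sub (by omega), Nat.cast_one]
  have hRd : (R : ℝ) ^ d ≤ (R ^ (d - 1) : ℝ) ^ 2 * δ := by
    have h1 : (R : ℝ) ^ (2 - (d : ℝ)) ≤ δ :=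
      (Real.rpow_le_rpow_of_exponent_le hR1 (by linarith)).trans hRδ
    calc (R : ℝ) ^ d = (R ^ (d - 1) : ℝ) ^ 2 * (R : ℝ) ^ (2 - (d : ℝ)) := by
          rw [hpow, ← Real.rpow_natCast (_ ^ _) 2, ← Real.rpow_mul hR0.le, ← Real.rpow_add hR0,
            ← Real.rpow_natCast]
          congr 1
          push_cast
          ring
      _ ≤ _ := by gcongr
  have hLpow : (R : ℝ) ^ (d - 1) ≤ q * L ^ ((d : ℝ) - 1) := by
    have e : L ^ ((d : ℝ) - 1) = L ^ (d - 1) := by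
      rw [← Real.rpow_natCast, Nat.cast_sub (by omega), Nat.cast_one]
    rw [e, ← mul_pow]
    gcongr
  have hLsq : (L ^ ((d : ℝ) - 1)) ^ 2 = L ^ (2 * (d : ℝ) - 2) := by
    rw [← Real.rpow_natCast (_ ^ _) 2, ← Real.rpow_mul hL0.le]
    congr 1
    push_cast
    ring
  set W : ℝ := L ^ ((d : ℝ) - 1)
  have hW : 0 < W := by positivity
  have hheight : ∀ ξ : Fin d → ℤ, latticeNorm ξ ≤ L → latticeHeight ξ ≤ R := fun ξ hξ =>
    latticeHeight_le_of_latticeNorm_le ξ R (hξ.trans hLR1)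
  refine ⟨fun ζ hζ1 hζL => ?_, fun a => ?_, fun a => ?_⟩
  · refine countLe_of_forall_finset _ (latticeBox d R)
      (fun ξ hξ => mem_latticeBox.2 (hheight ξ hξ.1)) _ fun X hX => ?_
    refine (card_slab_le_sqrt hd h ζ hh (ne_zero_of_one_le_latticeNorm hζ1) R hR (hheight ζ hζL)
      δ hδ0 hδ1.le B hB hbadR 0 X fun ξ hξ => ⟨hheight ξ (hX ξ hξ).1, ?_⟩).trans ?_
    · rw [sub_zero, ← latticeForm_symMatrix]
      exact (hX ξ hξ).2.le
    · calc _ ≤ c₁ * (q * W * Real.sqrt δ) := by gcongr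
        _ = c₁ * q * (W * Real.sqrt δ) := by ring
        _ ≤ _ := by
          gcongr
          have : 0 ≤ Real.sqrt (2 * c₃) * q + c₃ * q ^ 2 + 1 := by positivity
          linarith
  · refine countLe_of_forall_finset _ (latticeBox d R)
      (fun ξ hξ => mem_latticeBox.2 (hheight ξ hξ.1.le)) _ fun X hX => ?_
    refine (card_quad_le hd h hh R hR δ hδ0 B hB hbadR hRd a X fun η hη => ⟨fun i => ?_,
      (hX η hη).2.le⟩).trans ?_
    · linarith [abs_le_latticeNorm η i, (hX η hη).1]
    · calc _ ≤ Real.sqrt (2 * c₃) * (q * W * Real.sqrt δ) := by gcongr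
        _ = Real.sqrt (2 * c₃) * q * (W * Real.sqrt δ) := by ring
        _ ≤ _ := by
          gcongr
          have : 0 ≤ c₁ * q := by positivity
          have : 0 ≤ c₃ * q ^ 2 := by positivity
          linarith
  · refine countLe_of_forall_finset _ (latticeBox d R ×ˢ latticeBox d R)
      (fun p hp => Finset.mem_coe.2 (Finset.mem_product.2
        ⟨mem_latticeBox.2 (hheight _ hp.1), mem_latticeBox.2 (hheight _ hp.2.1)⟩)) _ fun P hP => ?_
    refine (card_pairs_le hd h hh R hR δ hδ0 B hB hbadR hRd a P fun p hp =>
      ⟨hheight _ (hP p hp).1, hheight _ (hP p hp).2.1, ?_⟩).trans ?_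
    · rw [← latticeForm_symMatrix]
      exact (hP p hp).2.2
    · rw [← hLsq]
      calc _ ≤ c₃ * ((q * W) ^ 2 * δ) := by gcongr
        _ = c₃ * q ^ 2 * (W ^ 2 * δ) := by ring
        _ ≤ _ := by
          gcongr
          have : 0 ≤ c₁ * q := by positivity
          have : 0 ≤ Real.sqrt (2 * c₃) * q := by positivity
          linarith

theorem theorem6p1 (d : ℕ) :
    ∃ r : ℝ, 0 < r ∧
      ∀ᵐ h : Sym2 (Fin d) → ℝ ∂(volume : Measure (Sym2 (Fin d) → ℝ)),
        (∀ i j : Fin d, |symMatrix h i j - (1 : Matrix (Fin d) (Fin d) ℝ) i j| ≤ r) →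
          ∀ κ : ℝ, 0 < κ → ∃ C : ℝ, 0 < C ∧
            ∀ L δ : ℝ, 1 ≤ L → L ^ (2 - (d : ℝ) + κ) < δ → δ < 1 →
              (∀ ζ : Fin d → ℤ, 1 ≤ latticeNorm ζ → latticeNorm ζ ≤ L →
                CountLe {ξ : Fin d → ℤ |
                    latticeNorm ξ ≤ L ∧ |latticeForm (symMatrix h) ζ ξ| < δ}
                  (C * (L ^ ((d : ℝ) - 1) * Real.sqrt δ))) ∧
              (∀ a : ℝ,
                CountLe {η : Fin d → ℤ |
                    latticeNorm η < L ∧ |latticeQuad (symMatrix h) η - a| < δ}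
                  (C * (L ^ ((d : ℝ) - 1) * Real.sqrt δ))) ∧
              (∀ a : ℝ,
                CountLe {p : (Fin d → ℤ) × (Fin d → ℤ) |
                    latticeNorm p.1 ≤ L ∧ latticeNorm p.2 ≤ L ∧
                      |latticeForm (symMatrix h) p.1 p.2 - a| ≤ δ}
                  (C * (L ^ (2 * (d : ℝ) - 2) * δ))) := by
  refine ⟨1 / (2 * (d + 1)), by positivity, ?_⟩
  -- For `d ≤ 2` the exponent `2 - d + κ` is positive, so `L^(2-d+κ) ≥ 1 > δ` and no `δ` is
  -- admissible.
  rcases lt_or_ge d 3 with hd | hd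
  · refine Filter.Eventually.of_forall fun h _ κ hκ => ⟨1, one_pos, fun L δ hL hδ hδ1 => ?_⟩
    have hd2 : (d : ℝ) ≤ 2 := by exact_mod_cast Nat.lt_succ_iff.1 hd
    have := Real.one_le_rpow hL (z := 2 - (d : ℝ) + κ) (by linarith)
    linarith
  -- The exceptional null set must not depend on `κ`, so only the countably many values `1/(k+1)`
  -- are used. A larger `κ` restricts `δ` further, and these values satisfy `κ ≤ 1`.
  have hae := ae_volume_of_ae_symBoxMeasure (ae_all_iff.2 fun k : ℕ =>
    ae_exists_badSum_le (d := d) (by omega) (1 / ((k : ℝ) + 1)) (by positivity))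
  filter_upwards [hae] with h hB hh κ hκ
  obtain ⟨k, hk⟩ := exists_nat_one_div_lt hκ
  obtain ⟨B, hB0, hbad⟩ := hB hh k
  obtain ⟨C, hC, hmain⟩ := countLe_of_badSum_le hd h hh (1 / ((k : ℝ) + 1)) (by positivity)
    (by rw [div_le_one (by positivity)]; linarith [Nat.cast_nonneg (α := ℝ) k]) B hB0 hbad
  refine ⟨C, hC, fun L δ hL hδ hδ1 => hmain L δ hL (lt_of_le_of_lt ?_ hδ) hδ1⟩
  exact Real.rpow_le_rpow_of_exponent_le hL (by linarith)
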